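/- Let $q\ge 2$ and let $X$ be (the vertex set of) a $q$-homogeneous tree, i.e. a connected graph without cycles in which every vertex has exactly $q+1$ neighbours; fix an origin $o\in X$ and write $|x|=d(o,x)$ for the graph distance. For $\alpha\in\mathbb{R}$ let $\mu_\alpha$ be the measure on $X$ with density $q^{-\alpha|x|}$ with respect to the counting measure, and $L^p_\alpha=L^p(X,\mu_\alpha)$ (complex-valued functions). A function $f\colon X\to\mathbb{C}$ is harmonic if $f(v)=\frac{1}{q+1}\sum_{u\sim v}f(u)$ for all $v\in X$. For $c>1$ let $K_c\colon X\times X\to\mathbb{C}$ be the reproducing kernel of the harmonic Bergman space $\mathcal{A}^2_c$, the Hilbert space of harmonic functions in $L^2_c$: $K_c(z,\cdot)\in\mathcal{A}^2_c$ and $g(z)=\sum_{x\in X}g(x)\overline{K_c(z,x)}\,q^{-c|x|}$ for all $g\in\mathcal{A}^2_c$, $z\in X$. For $a,b\in\mathbb{R}$ and $c>1$ put $$S_{a,b,c}f(z)=q^{-a|z|}\sum_{x\in X}|K_c(z,x)|\,f(x)\,q^{-b|x|},\qquad T_{a,b,c}f(z)=q^{-a|z|}\sum_{x\in X}K_c(z,x)\,f(x)\,q^{-b|x|}.$$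 Such an operator is bounded on $L^1_\alpha$ if there is a constant $C\geq 0$ such that for every $f\in L^1_\alpha$ the defining series converges absolutely at every $z\in X$ and the resulting function belongs to $L^1_\alpha$, with norm at most $C\|f\|_{L^1_\alpha}$. **Theorem.** Let $\alpha>1$, $c>1$ and $a,b\in\mathbb{R}$. The following conditions are equivalent: 1. $S_{a,b,c}$ is bounded on $L^1_\alpha$; 2. $T_{a,b,c}$ is bounded on $L^1_\alpha$; 3. either $c=a+b$ and $-a<\alpha-1<b-1$, or $c<a+b$ and $-a<\alpha-1\le b-1$. -/

import Mathlib

open MeasureTheory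
open scoped ENNReal NNReal

noncomputable section

/-- `G` is a `q`-homogeneous tree: a connected acyclic graph in which every vertex has exactly
`q + 1` neighbours. -/
structure IsHomogeneousTree {X : Type*} (G : SimpleGraph X) [G.LocallyFinite] (q : ℕ) : Prop where
  isTree : G.IsTree
  isRegular : G.IsRegularOfDegree (q + 1)

/-- The combinatorial Laplacian `L f (v) = f(v) - (q + 1)⁻¹ ∑_{u ∼ v} f(u)`. -/
def treeLaplacian {X : Type*} (G : SimpleGraph X) [G.LocallyFinite] (q : ℕ) (f : X → ℂ) (v : X) :
    ℂ :=
  f v - 1 / ((q : ℂ) + 1) * ∑ u ∈ G.neighborFinset v, f u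

/-- `f` is harmonic on the whole tree. -/
def IsTreeHarmonic {X : Type*} (G : SimpleGraph X) [G.LocallyFinite] (q : ℕ) (f : X → ℂ) : Prop :=
  ∀ v, treeLaplacian G q f v = 0

/-- The measure `μ_α` whose density with respect to the counting measure is
`x ↦ q ^ (-α |x|)`, where `|x| = d(o, x)`. -/
def expMeasure {X : Type*} [MeasurableSpace X] (G : SimpleGraph X) (q : ℕ) (o : X) (α : ℝ) :
    Measure X :=
  Measure.count.withDensity fun x => ENNReal.ofReal ((q : ℝ) ^ (-α * (G.dist o x : ℝ)))

theorem expMeasure_singleton {X : Type*} [MeasurableSpace X] [DiscreteMeasurableSpace X]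
    (G : SimpleGraph X) (q : ℕ) (o : X) (α : ℝ) (x : X) :
    expMeasure G q o α {x} = ENNReal.ofReal ((q : ℝ) ^ (-α * (G.dist o x : ℝ))) := by
  rw [expMeasure, withDensity_apply _ (MeasurableSet.of_discrete), Measure.restrict_singleton]
  simp

theorem expMeasure_singleton_ne_zero {X : Type*} [MeasurableSpace X] [DiscreteMeasurableSpace X]
    (G : SimpleGraph X) (q : ℕ) [q.AtLeastTwo] (o : X) (α : ℝ) (x : X) :
    expMeasure G q o α {x} ≠ 0 := by
  rw [expMeasure_singleton]
  have : (0 : ℝ) < q := by exact_mod_cast (by have := Nat.AtLeastTwo.prop (n := q); omega : 0 < q)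
  simpa using Real.rpow_pos_of_pos this _

theorem expMeasure_singleton_ne_top {X : Type*} [MeasurableSpace X] [DiscreteMeasurableSpace X]
    (G : SimpleGraph X) (q : ℕ) (o : X) (α : ℝ) (x : X) :
    expMeasure G q o α {x} ≠ ∞ := by
  rw [expMeasure_singleton]
  exact ENNReal.ofReal_ne_top

/-- A property that holds `μ_α`-almost everywhere holds at every vertex. -/
theorem forall_of_ae_expMeasure {X : Type*} [MeasurableSpace X] [DiscreteMeasurableSpace X]
    (G : SimpleGraph X) (q : ℕ) [q.AtLeastTwo] (o : X) (α : ℝ) {P : X → Prop}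
    (h : ∀ᵐ x ∂(expMeasure G q o α), P x) (x : X) : P x := by
  by_contra hx
  refine expMeasure_singleton_ne_zero G q o α x (measure_mono_null ?_ (ae_iff.mp h))
  simpa using hx

/-- The (everywhere defined) values of an element of `L²_α`, as a continuous linear map. -/
def lpCoe {X : Type*} [MeasurableSpace X] [DiscreteMeasurableSpace X]
    (G : SimpleGraph X) (q : ℕ) [q.AtLeastTwo] (o : X) (α : ℝ) :
    Lp ℂ 2 (expMeasure G q o α) →L[ℂ] X → ℂ where
  toFun f := f
  map_add' f g := funext (forall_of_ae_expMeasure G q o α (Lp.coeFn_add f g))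
  map_smul' c f := funext (forall_of_ae_expMeasure G q o α (Lp.coeFn_smul c f))
  cont := by
    refine continuous_pi fun x => ?_
    have hx := expMeasure_singleton_ne_top G q o α x
    have h0 : ((expMeasure G q o α).real {x} : ℂ) ≠ 0 := by
      rw [Complex.ofReal_ne_zero]
      exact (measureReal_ne_zero_iff hx).2 (expMeasure_singleton_ne_zero G q o α x)
    have key : (fun f : Lp ℂ 2 (expMeasure G q o α) => f x) = fun f =>
        ((expMeasure G q o α).real {x} : ℂ)⁻¹ *
          inner ℂ (indicatorConstLp 2 (MeasurableSet.singleton x) hx (1 : ℂ)) f := by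
      funext f
      rw [L2.inner_indicatorConstLp_one, integral_singleton, Complex.real_smul,
        inv_mul_cancel_left₀ h0]
    rw [key]
    fun_prop

theorem lpCoe_apply {X : Type*} [MeasurableSpace X] [DiscreteMeasurableSpace X]
    (G : SimpleGraph X) (q : ℕ) [q.AtLeastTwo] (o : X) (α : ℝ)
    (f : Lp ℂ 2 (expMeasure G q o α)) (x : X) : lpCoe G q o α f x = f x := rfl

theorem lpCoe_injective {X : Type*} [MeasurableSpace X] [DiscreteMeasurableSpace X]
    (G : SimpleGraph X) (q : ℕ) [q.AtLeastTwo] (o : X) (α : ℝ) :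
    Function.Injective (lpCoe G q o α) := fun _ _ h =>
  Lp.ext (Filter.Eventually.of_forall fun x => congrFun h x)

/-- The harmonic Bergman space `A²_α`: the harmonic functions on `X` that belong to `L²_α`, with
the inner product of `L²_α`. -/
def bergmanSpace {X : Type*} [MeasurableSpace X] [DiscreteMeasurableSpace X]
    (G : SimpleGraph X) [G.LocallyFinite] (q : ℕ) [q.AtLeastTwo] (o : X) (α : ℝ) :
    Submodule ℂ (Lp ℂ 2 (expMeasure G q o α)) where
  carrier := {f | IsTreeHarmonic G q f}
  add_mem' {f g} hf hg v := by
    have hf := hf v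
    have hg := hg v
    have e : ∀ x, (f + g : Lp ℂ 2 (expMeasure G q o α)) x = f x + g x :=
      fun x => congrFun ((lpCoe G q o α).map_add f g) x
    simp only [treeLaplacian, e, Finset.sum_add_distrib] at hf hg ⊢
    linear_combination hf + hg
  zero_mem' v := by
    have e : ∀ x, (0 : Lp ℂ 2 (expMeasure G q o α)) x = 0 :=
      fun x => congrFun ((lpCoe G q o α).map_zero) x
    simp only [treeLaplacian, e]
    simp
  smul_mem' c f hf v := by
    have hf := hf v
    have e : ∀ x, (c • f : Lp ℂ 2 (expMeasure G q o α)) x = c * f x :=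
      fun x => congrFun ((lpCoe G q o α).map_smul c f) x
    simp only [treeLaplacian, e, ← Finset.mul_sum] at hf ⊢
    linear_combination c * hf

theorem isClosed_bergmanSpace {X : Type*} [MeasurableSpace X] [DiscreteMeasurableSpace X]
    (G : SimpleGraph X) [G.LocallyFinite] (q : ℕ) [q.AtLeastTwo] (o : X) (α : ℝ) :
    IsClosed (bergmanSpace G q o α : Set (Lp ℂ 2 (expMeasure G q o α))) := by
  have hev : ∀ x, Continuous fun f : Lp ℂ 2 (expMeasure G q o α) => f x :=
    fun x => (continuous_apply x).comp (lpCoe G q o α).continuous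
  have : (bergmanSpace G q o α : Set (Lp ℂ 2 (expMeasure G q o α))) =
      ⋂ v, {f : Lp ℂ 2 (expMeasure G q o α) | treeLaplacian G q f v = 0} := by
    ext f
    simp only [Set.mem_iInter]
    rfl
  rw [this]
  refine isClosed_iInter fun v => isClosed_eq ?_ continuous_const
  unfold treeLaplacian
  exact (hev v).sub (continuous_const.mul (continuous_finsetSum _ fun u _ => hev u))

instance bergmanSpaceComplete {X : Type*} [MeasurableSpace X] [DiscreteMeasurableSpace X]
    (G : SimpleGraph X) [G.LocallyFinite] (q : ℕ) [q.AtLeastTwo] (o : X) (α : ℝ) :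
    CompleteSpace (bergmanSpace G q o α) :=
  (isClosed_bergmanSpace G q o α).completeSpace_coe

/-- Point evaluations are continuous on `A²_α`: it is a reproducing kernel Hilbert space. -/
instance bergmanSpaceRKHS {X : Type*} [MeasurableSpace X] [DiscreteMeasurableSpace X]
    (G : SimpleGraph X) [G.LocallyFinite] (q : ℕ) [q.AtLeastTwo] (o : X) (α : ℝ) :
    RKHS ℂ (bergmanSpace G q o α) X ℂ where
  coeCLM := (lpCoe G q o α).comp (bergmanSpace G q o α).subtypeL
  coeCLM_injective := (lpCoe_injective G q o α).comp Subtype.val_injective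

/-- The reproducing kernel `K_α(z, x) = K_{α,z}(x)` of `A²_α`, where `K_{α,z}` is the element
of `A²_α` that represents the evaluation at `z`. -/
def bergmanKernel {X : Type*} [MeasurableSpace X] [DiscreteMeasurableSpace X]
    (G : SimpleGraph X) [G.LocallyFinite] (q : ℕ) [q.AtLeastTwo] (o : X) (α : ℝ) (z x : X) : ℂ :=
  RKHS.kerFun (bergmanSpace G q o α) z 1 x

/-- The integral transform `f ↦ (z ↦ q^{-a|z|} ∑_x k(z, x) f(x) q^{-b|x|})` of a kernel `k`. -/
def weightedTransform {X : Type*} (G : SimpleGraph X) (q : ℕ) (o : X) (a b : ℝ)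
    (k : X → X → ℂ) (f : X → ℂ) (z : X) : ℂ :=
  (((q : ℝ) ^ (-a * (G.dist o z : ℝ)) : ℝ) : ℂ) *
    ∑' x, k z x * f x * (((q : ℝ) ^ (-b * (G.dist o x : ℝ)) : ℝ) : ℂ)

/-- Boundedness on `L¹_α` of the operator `f ↦ q^{-a|z|} ∑_x k(z, x) f(x) q^{-b|x|}`: for every
`f ∈ L¹_α` the series converges (absolutely) at every vertex `z`, its sum defines a function in
`L¹_α`, and the norm of that function is at most a fixed multiple of the norm of `f`. -/
def IsBoundedOnL1 {X : Type*} [MeasurableSpace X] (G : SimpleGraph X) (q : ℕ) (o : X)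
    (α a b : ℝ) (k : X → X → ℂ) : Prop :=
  ∃ C : ℝ≥0, ∀ f : X → ℂ, MemLp f 1 (expMeasure G q o α) →
    (∀ z, Summable fun x => k z x * f x * (((q : ℝ) ^ (-b * (G.dist o x : ℝ)) : ℝ) : ℂ)) ∧
    MemLp (weightedTransform G q o a b k f) 1 (expMeasure G q o α) ∧
    eLpNorm (weightedTransform G q o a b k f) 1 (expMeasure G q o α) ≤
      C * eLpNorm f 1 (expMeasure G q o α)

/-- The operator `S_{a,b,c}`, with kernel `|K_c|`, is bounded on `L¹_α`. -/
def IsBoundedS {X : Type*} [MeasurableSpace X] [DiscreteMeasurableSpace X]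
    (G : SimpleGraph X) [G.LocallyFinite] (q : ℕ) [q.AtLeastTwo] (o : X) (α a b c : ℝ) : Prop :=
  IsBoundedOnL1 G q o α a b fun z x => (‖bergmanKernel G q o c z x‖ : ℂ)

/-- The operator `T_{a,b,c}`, with kernel `K_c`, is bounded on `L¹_α`. -/
def IsBoundedT {X : Type*} [MeasurableSpace X] [DiscreteMeasurableSpace X]
    (G : SimpleGraph X) [G.LocallyFinite] (q : ℕ) [q.AtLeastTwo] (o : X) (α a b c : ℝ) : Prop :=
  IsBoundedOnL1 G q o α a b (bergmanKernel G q o c)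

end

/-! An integral operator is bounded on `L¹` exactly when it is uniformly bounded on point masses
(`isBoundedOnL1_iff`). Only the modulus of the kernel enters, so S and T behave alike. Since
|K_c(z,x)| = |K_c(x,z)|, the criterion says that the norm of K_c(z,·) in L¹_β, with β = a+α, is at
most a multiple of q^{(b-α)|z|}.

At z = o the kernel is a nonzero constant, which forces β > 1. For β > 1 the norm is comparable to
∑_{j≤|z|} r^j with r = q^{c-β} (`exists_tsum_bergmanKernel_le`, `exists_le_tsum_bergmanKernel`).
Such sums are O(ρ^n), with ρ = q^{b-α}, if and only if ρ ≥ 1, r ≤ ρ and not r = ρ = 1; in terms of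
exponents this is condition 3.

The norm estimates come from a recursion for the kernel along geodesics
(`bergmanKernel_sub_treeParent`). Let p be the parent of u and p' the parent of p. The functional g
↦ (g(u)-g(p)) - q⁻¹(g(p)-g(p')) is represented on the Bergman space by a multiple of an explicit
bounded harmonic function supported on the descendants of p (`treeBump`). Hence K_u - K_p equals
q⁻¹(K_p - K_{p'}) plus that multiple. Estimating the bumps in norm gives the upper bound; their
signs along the geodesic from o to z give the lower bound. -/

/-! ### The tree rooted at `o`: parents, children and generations of descendants. -/

open scoped Classical in
/-- The neighbour of `x` on the geodesic from `o` to `x` (and `o` itself if `x = o`). -/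
noncomputable def treeParent {X : Type*} (G : SimpleGraph X) (o x : X) : X :=
  if h : ∃ y, G.Adj x y ∧ G.dist o y + 1 = G.dist o x then h.choose else x

open scoped Classical in
/-- The neighbours of `v` that are further away from `o` than `v`. -/
noncomputable def treeChildren {X : Type*} (G : SimpleGraph X) [G.LocallyFinite] (o v : X) :
    Finset X :=
  {y ∈ G.neighborFinset v | G.dist o y = G.dist o v + 1}

open scoped Classical in
/-- The descendants of `v` at distance `n` from `v`. -/
noncomputable def treeDescendants {X : Type*} (G : SimpleGraph X) [G.LocallyFinite] (o : X) :
    ℕ → X → Finset X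
  | 0, v => {v}
  | n + 1, v => (treeChildren G o v).biUnion (treeDescendants G o n)

/-- `x` is a descendant of `v` (or `v` itself) in the tree rooted at `o`. -/
def IsTreeDescendant {X : Type*} (G : SimpleGraph X) (o v x : X) : Prop :=
  ∃ n, (treeParent G o)^[n] x = v

section Tree

variable {X : Type*} {G : SimpleGraph X} {q : ℕ} {o : X}

theorem SimpleGraph.Connected.exists_adj_dist_add_one (hG : G.Connected) {x : X} (hx : x ≠ o) :
    ∃ y, G.Adj x y ∧ G.dist o y + 1 = G.dist o x := by
  obtain ⟨w, hw⟩ := hG.exists_walk_length_eq_dist x o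
  cases w with
  | nil => exact absurd rfl hx
  | @cons _ y _ h p =>
    refine ⟨y, h, ?_⟩
    have h1 : G.dist y o ≤ p.length := SimpleGraph.dist_le p
    have h2 := h.diff_dist_adj (u := o)
    rw [SimpleGraph.Walk.length_cons] at hw
    rw [SimpleGraph.dist_comm] at h1
    rw [SimpleGraph.dist_comm] at hw
    omega

/-- Geodesics from `o` to `y` and to `z`, prolonged by the edge to `x`, are again geodesics, and a
tree has only one path from `o` to `x`. -/
theorem SimpleGraph.IsTree.eq_of_adj_of_dist_add_one (hG : G.IsTree) {x y z : X}
    (hy : G.Adj x y) (hy' : G.dist o y + 1 = G.dist o x)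
    (hz : G.Adj x z) (hz' : G.dist o z + 1 = G.dist o x) : y = z := by
  obtain ⟨p, hp⟩ := hG.connected.exists_walk_length_eq_dist o y
  obtain ⟨r, hr⟩ := hG.connected.exists_walk_length_eq_dist o z
  have hp' : (p.concat hy.symm).IsPath :=
    SimpleGraph.Walk.isPath_of_length_eq_dist _ (by simp [hp, hy'])
  have hr' : (r.concat hz.symm).IsPath :=
    SimpleGraph.Walk.isPath_of_length_eq_dist _ (by simp [hr, hz'])
  have := congrArg SimpleGraph.Walk.penultimate
    ((hG.existsUnique_path o x).unique hp' hr')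
  simpa using this

@[simp]
theorem treeParent_root : treeParent G o o = o := by
  rw [treeParent, dif_neg]
  rintro ⟨y, -, h⟩
  simp at h

theorem treeParent_spec (hG : G.IsTree) {x : X} (hx : x ≠ o) :
    G.Adj x (treeParent G o x) ∧ G.dist o (treeParent G o x) + 1 = G.dist o x := by
  have h := hG.connected.exists_adj_dist_add_one hx
  rw [treeParent, dif_pos h]
  exact h.choose_spec

theorem dist_treeParent (hG : G.IsTree) (x : X) :
    G.dist o (treeParent G o x) = G.dist o x - 1 := by
  by_cases hx : x = o
  · simp [hx]
  · have := (treeParent_spec hG hx).2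
    omega

theorem dist_root_eq_zero_iff (hG : G.IsTree) {x : X} : G.dist o x = 0 ↔ x = o := by
  rw [hG.connected.dist_eq_zero_iff, eq_comm]

theorem dist_iterate_treeParent (hG : G.IsTree) (x : X) (n : ℕ) :
    G.dist o ((treeParent G o)^[n] x) = G.dist o x - n := by
  induction n with
  | zero => rfl
  | succ n ih => rw [Function.iterate_succ_apply', dist_treeParent hG, ih]; omega

theorem IsTreeDescendant.refl (x : X) : IsTreeDescendant G o x x := ⟨0, rfl⟩

theorem isTreeDescendant_iff {v x : X} :
    IsTreeDescendant G o v x ↔ x = v ∨ IsTreeDescendant G o v (treeParent G o x) := by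
  constructor
  · rintro ⟨_ | n, hn⟩
    · exact .inl hn
    · exact .inr ⟨n, hn⟩
  · rintro (h | ⟨n, hn⟩)
    · exact ⟨0, h⟩
    · exact ⟨n + 1, hn⟩

theorem isTreeDescendant_root_iff {v : X} : IsTreeDescendant G o v o ↔ o = v := by
  refine ⟨?_, fun h => ⟨0, h⟩⟩
  rintro ⟨n, hn⟩
  rwa [Function.iterate_fixed treeParent_root] at hn

theorem IsTreeDescendant.dist_le (hG : G.IsTree) {v x : X} (h : IsTreeDescendant G o v x) :
    G.dist o v ≤ G.dist o x := by
  obtain ⟨n, rfl⟩ := h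
  rw [dist_iterate_treeParent hG]
  omega

theorem IsTreeDescendant.eq_of_dist_le (hG : G.IsTree) {v x : X} (h : IsTreeDescendant G o v x)
    (hd : G.dist o x ≤ G.dist o v) : x = v := by
  rcases isTreeDescendant_iff.1 h with h' | h'
  · exact h'
  · have h1 := h'.dist_le hG
    rw [dist_treeParent hG] at h1
    have hx : x = o := (dist_root_eq_zero_iff hG).1 (by omega)
    subst hx
    exact isTreeDescendant_root_iff.1 h

theorem IsTreeDescendant.treeParent_left {v x : X} (h : IsTreeDescendant G o v x) :
    IsTreeDescendant G o (treeParent G o v) x := by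
  obtain ⟨n, rfl⟩ := h
  exact ⟨n + 1, by rw [Function.iterate_succ_apply']⟩

theorem isTreeDescendant_root (hG : G.IsTree) (x : X) : IsTreeDescendant G o o x :=
  ⟨G.dist o x, (dist_root_eq_zero_iff hG).1 (by rw [dist_iterate_treeParent hG]; omega)⟩

theorem tree_induction (hG : G.IsTree) {P : X → Prop} (h0 : P o)
    (h1 : ∀ x, x ≠ o → P (treeParent G o x) → P x) (x : X) : P x := by
  generalize hn : G.dist o x = n
  induction n generalizing x with
  | zero => rwa [(dist_root_eq_zero_iff hG).1 hn]
  | succ n ih =>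
    have hx : x ≠ o := by rintro rfl; simp at hn
    exact h1 x hx (ih _ (by rw [dist_treeParent hG, hn]; rfl))

variable [G.LocallyFinite]

theorem mem_treeChildren (hG : G.IsTree) {v y : X} :
    y ∈ treeChildren G o v ↔ y ≠ o ∧ treeParent G o y = v := by
  rw [treeChildren, Finset.mem_filter, SimpleGraph.mem_neighborFinset]
  constructor
  · rintro ⟨h1, h2⟩
    have hy : y ≠ o := by rintro rfl; simp at h2
    obtain ⟨h3, h4⟩ := treeParent_spec hG hy
    exact ⟨hy, hG.eq_of_adj_of_dist_add_one h3 h4 h1.symm h2.symm⟩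
  · rintro ⟨hy, rfl⟩
    obtain ⟨h3, h4⟩ := treeParent_spec hG hy
    exact ⟨h3.symm, h4.symm⟩

theorem dist_of_mem_treeChildren {v y : X} (h : y ∈ treeChildren G o v) :
    G.dist o y = G.dist o v + 1 := (Finset.mem_filter.1 h).2

theorem sum_neighborFinset_eq {M : Type*} [AddCommMonoid M] (hG : G.IsTree) (f : X → M) {v : X}
    (hv : v ≠ o) : ∑ u ∈ G.neighborFinset v, f u =
      ∑ u ∈ treeChildren G o v, f u + f (treeParent G o v) := by
  classical
  obtain ⟨h1, h2⟩ := treeParent_spec hG hv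
  have h3 : treeParent G o v ∉ treeChildren G o v := by
    intro h
    have := dist_of_mem_treeChildren h
    omega
  have : G.neighborFinset v = insert (treeParent G o v) (treeChildren G o v) := by
    ext y
    rw [Finset.mem_insert, treeChildren, Finset.mem_filter, SimpleGraph.mem_neighborFinset]
    constructor
    · intro h
      rcases hG.dist_eq_dist_add_one_of_adj o h with h' | h'
      · exact .inl (hG.eq_of_adj_of_dist_add_one h h'.symm h1 h2)
      · exact .inr ⟨h, h'⟩
    · rintro (rfl | h)
      exacts [h1, h.1]
  rw [this, Finset.sum_insert h3, add_comm]

theorem treeChildren_root : treeChildren G o o = G.neighborFinset o := by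
  ext y
  rw [treeChildren, Finset.mem_filter, SimpleGraph.mem_neighborFinset]
  refine ⟨fun h => h.1, fun h => ⟨h, ?_⟩⟩
  rw [SimpleGraph.dist_self, SimpleGraph.dist_eq_one_iff_adj.2 h]

theorem card_treeChildren_root (hG : IsHomogeneousTree G q) :
    (treeChildren G o o).card = q + 1 := by
  rw [treeChildren_root, SimpleGraph.card_neighborFinset_eq_degree, hG.isRegular]

theorem card_treeChildren (hG : IsHomogeneousTree G q) {v : X} (hv : v ≠ o) :
    (treeChildren G o v).card = q := by
  have := sum_neighborFinset_eq (o := o) hG.isTree (fun _ => 1) hv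
  simp only [Finset.sum_const, SimpleGraph.card_neighborFinset_eq_degree, hG.isRegular v,
    smul_eq_mul, mul_one] at this
  omega

theorem mem_treeDescendants (hG : G.IsTree) {n : ℕ} {v x : X} :
    x ∈ treeDescendants G o n v ↔
      G.dist o x = G.dist o v + n ∧ (treeParent G o)^[n] x = v := by
  classical
  induction n generalizing v with
  | zero =>
    rw [treeDescendants, Finset.mem_singleton]
    exact ⟨fun h => ⟨by rw [h, add_zero], h⟩, fun h => h.2⟩
  | succ n ih =>
    rw [treeDescendants, Finset.mem_biUnion]
    constructor
    · rintro ⟨w, hw, hx⟩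
      obtain ⟨h1, h2⟩ := ih.1 hx
      rw [dist_of_mem_treeChildren hw] at h1
      rw [Function.iterate_succ_apply', h2]
      exact ⟨by omega, ((mem_treeChildren hG).1 hw).2⟩
    · rintro ⟨h1, h2⟩
      rw [Function.iterate_succ_apply'] at h2
      have hd := dist_iterate_treeParent (o := o) hG x n
      refine ⟨_, (mem_treeChildren hG).2 ⟨?_, h2⟩, ih.2 ⟨by omega, rfl⟩⟩
      rw [ne_eq, ← dist_root_eq_zero_iff hG]
      omega

theorem mem_treeDescendants_iff (hG : G.IsTree) {n : ℕ} {v x : X} :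
    x ∈ treeDescendants G o n v ↔
      G.dist o x = G.dist o v + n ∧ IsTreeDescendant G o v x := by
  rw [mem_treeDescendants hG]
  refine ⟨fun h => ⟨h.1, n, h.2⟩, fun ⟨h1, m, hm⟩ => ⟨h1, ?_⟩⟩
  have h2 := dist_iterate_treeParent (o := o) hG x m
  rw [hm] at h2
  rcases le_or_gt m (G.dist o x) with h | h
  · obtain rfl : m = n := by omega
    exact hm
  -- More iterations than |x| only stay at the root, which is its own parent.
  · have hv : v = o := (dist_root_eq_zero_iff hG).1 (by omega)
    subst hv
    refine (dist_root_eq_zero_iff hG).1 ?_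
    rw [dist_iterate_treeParent hG, h1, SimpleGraph.dist_self]
    omega

theorem mem_treeDescendants_root (hG : G.IsTree) {n : ℕ} {x : X} :
    x ∈ treeDescendants G o n o ↔ G.dist o x = n := by
  rw [mem_treeDescendants_iff hG, SimpleGraph.dist_self, zero_add]
  exact and_iff_left (isTreeDescendant_root hG x)

theorem sum_treeDescendants_succ {M : Type*} [AddCommMonoid M] (hG : G.IsTree) (f : X → M)
    (n : ℕ) (v : X) : ∑ x ∈ treeDescendants G o (n + 1) v, f x =
      ∑ u ∈ treeChildren G o v, ∑ x ∈ treeDescendants G o n u, f x := by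
  classical
  rw [treeDescendants, Finset.sum_biUnion]
  intro u _ w _ huw
  refine Finset.disjoint_left.2 fun x hx hx' => huw ?_
  rw [← ((mem_treeDescendants hG).1 hx).2, ((mem_treeDescendants hG).1 hx').2]

theorem card_treeDescendants (hG : IsHomogeneousTree G q) (n : ℕ) {v : X} (hv : v ≠ o) :
    (treeDescendants G o n v).card = q ^ n := by
  induction n generalizing v with
  | zero => simp [treeDescendants]
  | succ n ih =>
    rw [Finset.card_eq_sum_ones, sum_treeDescendants_succ hG.isTree]
    simp only [← Finset.card_eq_sum_ones]
    rw [Finset.sum_congr rfl fun u hu => ih ((mem_treeChildren hG.isTree).1 hu).1,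
      Finset.sum_const, card_treeChildren hG hv, smul_eq_mul, pow_succ']

theorem card_treeDescendants_root (hG : IsHomogeneousTree G q) (n : ℕ) :
    (treeDescendants G o (n + 1) o).card = (q + 1) * q ^ n := by
  rw [Finset.card_eq_sum_ones, sum_treeDescendants_succ hG.isTree]
  simp only [← Finset.card_eq_sum_ones]
  rw [Finset.sum_congr rfl fun u hu =>
      card_treeDescendants hG n ((mem_treeChildren hG.isTree).1 hu).1,
    Finset.sum_const, card_treeChildren_root hG, smul_eq_mul]

theorem card_treeDescendants_le [q.AtLeastTwo] (hG : IsHomogeneousTree G q) (n : ℕ) (v : X) :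
    (treeDescendants G o n v).card ≤ 2 * q ^ n := by
  have hq := Nat.AtLeastTwo.prop (n := q)
  by_cases hv : v = o
  · subst hv
    cases n with
    | zero => simp [treeDescendants]
    | succ n =>
      rw [card_treeDescendants_root hG, pow_succ', ← mul_assoc]
      gcongr
      omega
  · rw [card_treeDescendants hG n hv]
    omega

theorem pow_le_card_treeDescendants (hG : IsHomogeneousTree G q) (n : ℕ) (v : X) :
    q ^ n ≤ (treeDescendants G o n v).card := by
  by_cases hv : v = o
  · subst hv
    cases n with
    | zero => simp [treeDescendants]
    | succ n =>
      rw [card_treeDescendants_root hG, pow_succ']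
      gcongr
      omega
  · rw [card_treeDescendants hG n hv]

theorem countable_of_isTree (hG : G.IsTree) : Countable X := by
  have : Nonempty X := hG.connected.nonempty
  obtain ⟨o⟩ := this
  have : (Set.univ : Set X) = ⋃ n, (treeDescendants G o n o : Set X) := by
    ext x
    simp only [Set.mem_univ, Set.mem_iUnion, Finset.mem_coe, true_iff]
    exact ⟨_, (mem_treeDescendants_root hG).2 rfl⟩
  rw [← Set.countable_univ_iff, this]
  exact Set.countable_iUnion fun n => Finset.countable_toSet _

end Tree

/-! ### Geometric sums and exponential weights. -/

/-- `1 + q⁻¹ + ⋯ + q^{-(n-1)}`. -/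
noncomputable def inverseGeomSum (q n : ℕ) : ℝ := ∑ i ∈ Finset.range n, ((q : ℝ)⁻¹) ^ i

/-- The density `x ↦ q ^ (-β |x|)` of `expMeasure`, with real values. -/
noncomputable abbrev treeWeight {X : Type*} (G : SimpleGraph X) (q : ℕ) (o : X) (β : ℝ) (x : X) :
    ℝ := (q : ℝ) ^ (-β * (G.dist o x : ℝ))

section InverseGeomSum

variable {q : ℕ}

theorem cast_pos_of_atLeastTwo (q : ℕ) [q.AtLeastTwo] : (0 : ℝ) < q := by
  have := Nat.AtLeastTwo.prop (n := q)
  exact_mod_cast (by omega : 0 < q)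

theorem one_lt_cast_of_atLeastTwo (q : ℕ) [q.AtLeastTwo] : (1 : ℝ) < q := by
  have := Nat.AtLeastTwo.prop (n := q)
  exact_mod_cast (by omega : 1 < q)

theorem inv_cast_le_half (q : ℕ) [q.AtLeastTwo] : (q : ℝ)⁻¹ ≤ 1 / 2 := by
  rw [one_div]
  exact inv_anti₀ two_pos (by exact_mod_cast Nat.AtLeastTwo.prop (n := q))

@[simp]
theorem inverseGeomSum_zero : inverseGeomSum q 0 = 0 := by simp [inverseGeomSum]

theorem inverseGeomSum_succ (n : ℕ) :
    inverseGeomSum q (n + 1) = (q : ℝ)⁻¹ * inverseGeomSum q n + 1 := geom_sum_succ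

@[simp]
theorem inverseGeomSum_one : inverseGeomSum q 1 = 1 := by simp [inverseGeomSum]

theorem inverseGeomSum_nonneg (n : ℕ) : 0 ≤ inverseGeomSum q n :=
  Finset.sum_nonneg fun _ _ => by positivity

theorem inverseGeomSum_le_two [q.AtLeastTwo] (n : ℕ) : inverseGeomSum q n ≤ 2 := by
  induction n with
  | zero => simp
  | succ n ih =>
    rw [inverseGeomSum_succ]
    have := mul_le_mul (inv_cast_le_half q) ih (inverseGeomSum_nonneg n) (by norm_num)
    linarith

/-- This is the mean value property for a function of the depth alone: one neighbour above, `q`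
below. Together with the value 0 at depth 0 it makes `treeBump` harmonic. -/
theorem inverseGeomSum_harmonic [q.AtLeastTwo] (n : ℕ) :
    ((q : ℝ) + 1) * inverseGeomSum q (n + 1) =
      q * inverseGeomSum q (n + 2) + inverseGeomSum q n := by
  have := cast_pos_of_atLeastTwo q
  rw [inverseGeomSum_succ (n + 1), inverseGeomSum_succ n]
  field_simp
  ring

end InverseGeomSum

section Weight

variable {X : Type*} {G : SimpleGraph X} {q : ℕ} [q.AtLeastTwo] {o : X}

theorem treeWeight_pos (β : ℝ) (x : X) : 0 < treeWeight G q o β x :=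
  Real.rpow_pos_of_pos (cast_pos_of_atLeastTwo q) _

theorem rpow_neg_mul_natCast (β : ℝ) (n : ℕ) : (q : ℝ) ^ (-β * (n : ℝ)) = ((q : ℝ) ^ (-β)) ^ n := by
  rw [Real.rpow_mul (cast_pos_of_atLeastTwo q).le, Real.rpow_natCast]

theorem treeWeight_eq_of_dist {x p : X} {n : ℕ} (h : G.dist o x = G.dist o p + n) (β : ℝ) :
    treeWeight G q o β x = treeWeight G q o β p * ((q : ℝ) ^ (-β)) ^ n := by
  rw [treeWeight, treeWeight, rpow_neg_mul_natCast, rpow_neg_mul_natCast, h, pow_add]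

theorem treeWeight_add (β γ : ℝ) (x : X) :
    treeWeight G q o (β + γ) x = treeWeight G q o β x * treeWeight G q o γ x := by
  rw [treeWeight, ← Real.rpow_add (cast_pos_of_atLeastTwo q)]
  congr 1
  ring

theorem mul_rpow_neg (β : ℝ) : (q : ℝ) * (q : ℝ) ^ (-β) = (q : ℝ) ^ (1 - β) := by
  rw [sub_eq_add_neg, Real.rpow_add (cast_pos_of_atLeastTwo q), Real.rpow_one]

theorem mul_rpow_neg_lt_one {β : ℝ} (hβ : 1 < β) : (q : ℝ) * (q : ℝ) ^ (-β) < 1 := by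
  rw [mul_rpow_neg]
  exact Real.rpow_lt_one_of_one_lt_of_neg (one_lt_cast_of_atLeastTwo q) (by linarith)

end Weight

/-! ### Summation by generations. -/

section Regroup

variable {X : Type*} {G : SimpleGraph X} [G.LocallyFinite] {q : ℕ} {o : X}

/-- Because of truncated subtraction the fibre over 0 also contains the vertices closer to `o` than
`p`; the support hypothesis removes them. -/
theorem tsum_fiber_descendants {M : Type*} [AddCommMonoid M] [TopologicalSpace M] [T2Space M]
    (hG : G.IsTree) {p : X} {F : X → M} (hp : ∀ x, F x ≠ 0 → IsTreeDescendant G o p x) (n : ℕ) :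
    ∑' x : (fun x => G.dist o x - G.dist o p) ⁻¹' {n}, F x =
      ∑ x ∈ treeDescendants G o n p, F x := by
  have hmem : ∀ x ∈ treeDescendants G o n p,
      x ∈ (fun x => G.dist o x - G.dist o p) ⁻¹' {n} := fun x hx => by
    have := ((mem_treeDescendants_iff hG).1 hx).1
    simp only [Set.mem_preimage, Set.mem_singleton_iff]
    omega
  rw [tsum_subtype, tsum_eq_sum (s := treeDescendants G o n p)]
  · exact Finset.sum_congr rfl fun x hx => Set.indicator_of_mem (hmem x hx) _
  · intro x hx
    by_contra h
    have h1 : x ∈ (fun x => G.dist o x - G.dist o p) ⁻¹' {n} := by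
      by_contra h'
      exact h (Set.indicator_of_notMem h' _)
    rw [Set.indicator_of_mem h1] at h
    have h2 := hp x h
    have h3 := h2.dist_le hG
    simp only [Set.mem_preimage, Set.mem_singleton_iff] at h1
    exact hx ((mem_treeDescendants_iff hG).2 ⟨by omega, h2⟩)

theorem hasSum_sum_treeDescendants (hG : G.IsTree) {p : X} {F : X → ℂ}
    (hp : ∀ x, F x ≠ 0 → IsTreeDescendant G o p x) (hF : Summable F) :
    HasSum (fun n => ∑ x ∈ treeDescendants G o n p, F x) (∑' x, F x) := by
  have := hF.hasSum.tsum_fiberwise fun x => G.dist o x - G.dist o p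
  simpa only [tsum_fiber_descendants hG hp] using this

theorem ENNReal.tsum_sum_treeDescendants (hG : G.IsTree) {p : X} {F : X → ℝ≥0∞}
    (hp : ∀ x, F x ≠ 0 → IsTreeDescendant G o p x) :
    ∑' n, ∑ x ∈ treeDescendants G o n p, F x = ∑' x, F x := by
  rw [← ENNReal.tsum_fiberwise F fun x => G.dist o x - G.dist o p]
  simp only [tsum_fiber_descendants hG hp]

-- Generation n below `p` has at most 2qⁿ vertices, each of weight q^{-βn} relative to `p`, so the
-- masses decay with ratio q^{1-β} < 1, uniformly in `p`.
open scoped Classical in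
theorem exists_tsum_treeWeight_le [q.AtLeastTwo] (hG : IsHomogeneousTree G q) {β : ℝ}
    (hβ : 1 < β) : ∃ C : ℝ≥0, ∀ p, ∑' x, (if IsTreeDescendant G o p x then
      ENNReal.ofReal (treeWeight G q o β x) else 0) ≤ C * ENNReal.ofReal (treeWeight G q o β p) := by
  have hq := cast_pos_of_atLeastTwo q
  set r : ℝ := (q : ℝ) * (q : ℝ) ^ (-β) with hr
  have hr0 : 0 ≤ r := by positivity
  have hsum : Summable fun n : ℕ => 2 * r ^ n :=
    (summable_geometric_of_lt_one hr0 (mul_rpow_neg_lt_one hβ)).mul_left 2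
  refine ⟨(∑' n : ℕ, 2 * r ^ n).toNNReal, fun p => ?_⟩
  rw [← ENNReal.tsum_sum_treeDescendants hG.isTree (p := p) (fun x hx => by
    by_contra h
    exact hx (if_neg h))]
  have hterm : ∀ n : ℕ, ∑ x ∈ treeDescendants G o n p, (if IsTreeDescendant G o p x then
      ENNReal.ofReal (treeWeight G q o β x) else 0) ≤
      ENNReal.ofReal (2 * r ^ n) * ENNReal.ofReal (treeWeight G q o β p) := by
    intro n
    have : ∀ x ∈ treeDescendants G o n p, (if IsTreeDescendant G o p x then
        ENNReal.ofReal (treeWeight G q o β x) else 0) =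
        ENNReal.ofReal (treeWeight G q o β p * ((q : ℝ) ^ (-β)) ^ n) := fun x hx => by
      obtain ⟨h1, h2⟩ := (mem_treeDescendants_iff hG.isTree).1 hx
      rw [if_pos h2, treeWeight_eq_of_dist h1]
    rw [Finset.sum_congr rfl this, Finset.sum_const, nsmul_eq_mul, ← ENNReal.ofReal_natCast,
      ← ENNReal.ofReal_mul (by positivity), ← ENNReal.ofReal_mul (by positivity)]
    refine ENNReal.ofReal_le_ofReal ?_
    have hcard : ((treeDescendants G o n p).card : ℝ) ≤ 2 * (q : ℝ) ^ n := by
      exact_mod_cast card_treeDescendants_le hG n p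
    rw [hr, mul_pow]
    have := treeWeight_pos (G := G) (q := q) (o := o) β p
    calc _ ≤ 2 * (q : ℝ) ^ n * (treeWeight G q o β p * ((q : ℝ) ^ (-β)) ^ n) := by gcongr
      _ = _ := by ring
  refine (ENNReal.tsum_le_tsum hterm).trans ?_
  rw [ENNReal.tsum_mul_right, ← ENNReal.ofReal_tsum_of_nonneg (fun n => by positivity) hsum]
  rfl

theorem tsum_treeWeight_ne_top [q.AtLeastTwo] (hG : IsHomogeneousTree G q) {β : ℝ}
    (hβ : 1 < β) : ∑' x, ENNReal.ofReal (treeWeight G q o β x) ≠ ∞ := by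
  classical
  obtain ⟨C, hC⟩ := exists_tsum_treeWeight_le (o := o) hG hβ
  have := hC o
  simp only [isTreeDescendant_root hG.isTree, if_true] at this
  exact ne_top_of_le_ne_top (by finiteness) this

theorem summable_treeWeight [q.AtLeastTwo] (hG : IsHomogeneousTree G q) {β : ℝ}
    (hβ : 1 < β) : Summable (treeWeight G q o β) := by
  have := ENNReal.summable_toReal (tsum_treeWeight_ne_top (o := o) hG hβ)
  simpa only [ENNReal.toReal_ofReal (treeWeight_pos β _).le] using this

/-- For β ≤ 1 each of the infinitely many spheres around `o` has mass at least 1. -/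
theorem one_lt_of_tsum_treeWeight_ne_top [q.AtLeastTwo] (hG : IsHomogeneousTree G q) {β : ℝ}
    (h : ∑' x, ENNReal.ofReal (treeWeight G q o β x) ≠ ∞) : 1 < β := by
  have hq := cast_pos_of_atLeastTwo q
  by_contra! hβ
  refine h (top_unique ?_)
  rw [← ENNReal.tsum_sum_treeDescendants hG.isTree (o := o) (p := o)
    (fun x _ => isTreeDescendant_root hG.isTree x), ← ENNReal.tsum_const_eq_top_of_ne_zero
    (α := ℕ) one_ne_zero]
  refine ENNReal.tsum_le_tsum fun n => ?_
  have : ∀ x ∈ treeDescendants G o n o, ENNReal.ofReal (treeWeight G q o β x) =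
      ENNReal.ofReal (((q : ℝ) ^ (-β)) ^ n) := fun x hx => by
    rw [treeWeight, (mem_treeDescendants_root hG.isTree).1 hx, rpow_neg_mul_natCast]
  rw [Finset.sum_congr rfl this, Finset.sum_const, nsmul_eq_mul, ← ENNReal.ofReal_natCast,
    ← ENNReal.ofReal_mul (by positivity), ← ENNReal.ofReal_one]
  refine ENNReal.ofReal_le_ofReal ?_
  have hcard : (q : ℝ) ^ n ≤ ((treeDescendants G o n o).card : ℝ) := by
    exact_mod_cast pow_le_card_treeDescendants hG n o
  calc (1 : ℝ) ≤ ((q : ℝ) * (q : ℝ) ^ (-β)) ^ n := by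
        rw [mul_rpow_neg]
        exact one_le_pow₀ (Real.one_le_rpow (one_lt_cast_of_atLeastTwo q).le (by linarith))
    _ = (q : ℝ) ^ n * ((q : ℝ) ^ (-β)) ^ n := mul_pow _ _ _
    _ ≤ _ := by gcongr

end Regroup

/-! ### Sums of harmonic functions over generations. -/

section Harmonic

variable {X : Type*} {G : SimpleGraph X} [G.LocallyFinite] {q : ℕ} {o : X} {g : X → ℂ}

theorem isTreeHarmonic_iff : IsTreeHarmonic G q g ↔
    ∀ v, ∑ u ∈ G.neighborFinset v, g u = ((q : ℂ) + 1) * g v := by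
  refine forall_congr' fun v => ?_
  have hq : (q : ℂ) + 1 ≠ 0 := by exact_mod_cast q.succ_ne_zero
  rw [treeLaplacian, sub_eq_zero]
  constructor
  · intro h
    rw [h]
    field_simp
  · intro h
    rw [h]
    field_simp

theorem IsTreeHarmonic.sum_treeChildren (hG : G.IsTree) (hg : IsTreeHarmonic G q g) {v : X}
    (hv : v ≠ o) : ∑ u ∈ treeChildren G o v, g u = ((q : ℂ) + 1) * g v - g (treeParent G o v) := by
  rw [← isTreeHarmonic_iff.1 hg v, sum_neighborFinset_eq hG g hv, add_sub_cancel_right]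

theorem IsTreeHarmonic.sum_treeChildren_root (hg : IsTreeHarmonic G q g) :
    ∑ u ∈ treeChildren G o o, g u = ((q : ℂ) + 1) * g o := by
  rw [← isTreeHarmonic_iff.1 hg o, treeChildren_root]

variable [q.AtLeastTwo]

/-- Harmonicity at v ≠ o says that the increments of `g` from v to its q children add up to the
increment into v. So the mean increment shrinks by q⁻¹ per generation, and the mean over a
generation is a partial geometric sum. -/
theorem IsTreeHarmonic.sum_treeDescendants (hG : IsHomogeneousTree G q)
    (hg : IsTreeHarmonic G q g) (n : ℕ) {u : X} (hu : u ≠ o) :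
    ∑ x ∈ treeDescendants G o n u, g x = (q : ℂ) ^ n * (g (treeParent G o u) +
      (g u - g (treeParent G o u)) * (inverseGeomSum q (n + 1) : ℂ)) := by
  induction n generalizing u with
  | zero => simp [treeDescendants]
  | succ n ih =>
    have hq : (q : ℂ) ≠ 0 := by exact_mod_cast (cast_pos_of_atLeastTwo q).ne'
    have : ∀ v ∈ treeChildren G o u, ∑ x ∈ treeDescendants G o n v, g x =
        (q : ℂ) ^ n * (g u * (1 - (inverseGeomSum q (n + 1) : ℂ))) +
          (q : ℂ) ^ n * (inverseGeomSum q (n + 1) : ℂ) * g v := fun v hv => by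
      obtain ⟨h1, h2⟩ := (mem_treeChildren hG.isTree).1 hv
      rw [ih h1, h2]
      ring
    rw [sum_treeDescendants_succ hG.isTree, Finset.sum_congr rfl this, Finset.sum_add_distrib,
      Finset.sum_const, ← Finset.mul_sum, hg.sum_treeChildren hG.isTree hu,
      card_treeChildren hG hu, inverseGeomSum_succ (n + 1), nsmul_eq_mul]
    push_cast
    field_simp
    ring

theorem IsTreeHarmonic.sum_treeDescendants_root (hG : IsHomogeneousTree G q)
    (hg : IsTreeHarmonic G q g) (n : ℕ) :
    ∑ x ∈ treeDescendants G o n o, g x = ((treeDescendants G o n o).card : ℂ) * g o := by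
  cases n with
  | zero => simp [treeDescendants]
  | succ n =>
    have : ∀ v ∈ treeChildren G o o, ∑ x ∈ treeDescendants G o n v, g x =
        (q : ℂ) ^ n * (g o * (1 - (inverseGeomSum q (n + 1) : ℂ))) +
          (q : ℂ) ^ n * (inverseGeomSum q (n + 1) : ℂ) * g v := fun v hv => by
      obtain ⟨h1, h2⟩ := (mem_treeChildren hG.isTree).1 hv
      rw [hg.sum_treeDescendants hG n h1, h2]
      ring
    rw [sum_treeDescendants_succ hG.isTree, Finset.sum_congr rfl this, Finset.sum_add_distrib,
      Finset.sum_const, ← Finset.mul_sum, hg.sum_treeChildren_root,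
      card_treeChildren_root hG, card_treeDescendants_root hG, nsmul_eq_mul]
    push_cast
    ring

/-- The descendants of the siblings of `u` balance those of `u`. -/
theorem IsTreeHarmonic.sum_treeDescendants_sub (hG : IsHomogeneousTree G q)
    (hg : IsTreeHarmonic G q g) (n : ℕ) {u : X} (hu : u ≠ o) :
    ∑ x ∈ treeDescendants G o n u, g x - ((treeChildren G o (treeParent G o u)).card : ℂ)⁻¹ *
      ∑ x ∈ treeDescendants G o (n + 1) (treeParent G o u), g x =
    (q : ℂ) ^ n * (inverseGeomSum q (n + 1) : ℂ) * ((g u - g (treeParent G o u)) -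
      (q : ℂ)⁻¹ * (g (treeParent G o u) - g (treeParent G o (treeParent G o u)))) := by
  have hq : (q : ℂ) ≠ 0 := by exact_mod_cast (cast_pos_of_atLeastTwo q).ne'
  have hq1 : (q : ℂ) + 1 ≠ 0 := by exact_mod_cast q.succ_ne_zero
  rw [hg.sum_treeDescendants hG n hu]
  -- At the root the last difference vanishes, `o` being its own parent, and there are `q + 1`
  -- children instead of `q`.
  by_cases hp : treeParent G o u = o
  · rw [hp, treeParent_root, hg.sum_treeDescendants_root hG, card_treeChildren_root hG,
      card_treeDescendants_root hG]
    push_cast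
    field_simp
    ring
  · rw [hg.sum_treeDescendants hG _ hp, card_treeChildren hG hp, inverseGeomSum_succ (n + 1)]
    push_cast
    field_simp
    ring

end Harmonic

/-! ### Integrals against the exponential measure as weighted sums. -/

section ExpMeasure

variable {X : Type*} [MeasurableSpace X] [DiscreteMeasurableSpace X] {G : SimpleGraph X}
  {q : ℕ} {o : X}

theorem lintegral_expMeasure (β : ℝ) (f : X → ℝ≥0∞) :
    ∫⁻ x, f x ∂(expMeasure G q o β) = ∑' x, ENNReal.ofReal (treeWeight G q o β x) * f x := by
  rw [expMeasure, lintegral_withDensity_eq_lintegral_mul _ Measurable.of_discrete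
    Measurable.of_discrete, lintegral_count]
  rfl

theorem eLpNorm_one_expMeasure (β : ℝ) (f : X → ℂ) :
    eLpNorm f 1 (expMeasure G q o β) = ∑' x, ENNReal.ofReal (treeWeight G q o β x) * ‖f x‖ₑ := by
  rw [eLpNorm_one_eq_lintegral_enorm, lintegral_expMeasure]

theorem memLp_one_expMeasure_iff (β : ℝ) (f : X → ℂ) :
    MemLp f 1 (expMeasure G q o β) ↔
      ∑' x, ENNReal.ofReal (treeWeight G q o β x) * ‖f x‖ₑ < ∞ := by
  rw [← eLpNorm_one_expMeasure]
  exact and_iff_right Measurable.of_discrete.aestronglyMeasurable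

theorem measureReal_expMeasure_singleton [q.AtLeastTwo] (β : ℝ) (x : X) :
    (expMeasure G q o β).real {x} = treeWeight G q o β x := by
  rw [Measure.real, expMeasure_singleton, ENNReal.toReal_ofReal (treeWeight_pos β x).le]

variable [G.LocallyFinite] [q.AtLeastTwo]

theorem isFiniteMeasure_expMeasure (hG : IsHomogeneousTree G q) {β : ℝ} (hβ : 1 < β) :
    IsFiniteMeasure (expMeasure G q o β) := by
  refine ⟨?_⟩
  rw [← lintegral_one, lintegral_expMeasure]
  simpa only [mul_one] using (tsum_treeWeight_ne_top hG hβ).lt_top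

theorem hasSum_inner_bergmanSpace (hG : G.IsTree) {c : ℝ} (f g : bergmanSpace G q o c) :
    HasSum (fun x => (treeWeight G q o c x : ℂ) * (starRingEnd ℂ (f x) * g x)) (inner ℂ f g) := by
  have : Countable X := countable_of_isTree hG
  have hint : Integrable (fun x => inner ℂ ((f : Lp ℂ 2 (expMeasure G q o c)) x)
      ((g : Lp ℂ 2 (expMeasure G q o c)) x)) (expMeasure G q o c) := L2.integrable_inner _ _
  have h1 : inner ℂ f g = ∑' x, (treeWeight G q o c x : ℂ) * (starRingEnd ℂ (f x) * g x) := by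
    rw [Submodule.coe_inner, L2.inner_def, integral_countable hint]
    refine tsum_congr fun x => ?_
    rw [measureReal_expMeasure_singleton, Complex.real_smul, RCLike.inner_apply,
      mul_comm ((g : Lp ℂ 2 (expMeasure G q o c)) x)]
    rfl
  have h2 : ∑' x, ENNReal.ofReal (treeWeight G q o c x) *
      ‖starRingEnd ℂ (f x) * g x‖ₑ ≠ ∞ := by
    have := hint.2
    rw [HasFiniteIntegral, lintegral_expMeasure] at this
    refine ne_of_eq_of_ne (tsum_congr fun x => ?_) this.ne
    rw [RCLike.inner_apply, mul_comm ((g : Lp ℂ 2 (expMeasure G q o c)) x)]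
    rfl
  rw [h1]
  refine (Summable.of_norm ?_).hasSum
  refine (ENNReal.summable_toReal h2).congr fun x => ?_
  rw [ENNReal.toReal_mul, ENNReal.toReal_ofReal (treeWeight_pos c x).le, toReal_enorm,
    norm_mul (_ : ℂ) (_ * _), Complex.norm_real, Real.norm_of_nonneg (treeWeight_pos c x).le]

/-- The measure is finite for c > 1, so bounded functions are square integrable. This puts the
constants and the bumps into the Bergman space. -/
theorem exists_bergmanSpace_of_bounded (hG : IsHomogeneousTree G q) {c : ℝ} (hc : 1 < c)
    {f : X → ℂ} (hf : IsTreeHarmonic G q f) (M : ℝ) (hM : ∀ x, ‖f x‖ ≤ M) :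
    ∃ F : bergmanSpace G q o c, ∀ x, F x = f x := by
  have := isFiniteMeasure_expMeasure (o := o) hG hc
  have hmem : MemLp f 2 (expMeasure G q o c) :=
    MemLp.of_bound Measurable.of_discrete.aestronglyMeasurable M (Filter.Eventually.of_forall hM)
  have hval : ∀ x, hmem.toLp f x = f x := forall_of_ae_expMeasure G q o c hmem.coeFn_toLp
  refine ⟨⟨hmem.toLp f, ?_⟩, hval⟩
  change IsTreeHarmonic G q (hmem.toLp f)
  rwa [funext hval]

theorem bergmanSpace_isTreeHarmonic {c : ℝ} (f : bergmanSpace G q o c) :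
    IsTreeHarmonic G q f := f.2

end ExpMeasure

/-! ### The harmonic bump attached to a vertex. -/

section Bump

open scoped Classical in
/-- The harmonic function that vanishes off the descendants of the parent `p` of `u`, and whose
restriction to the descendants of each child of `p` is radial: the value of the constant depends
on whether this child is `u`. -/
noncomputable def treeBump {X : Type*} (G : SimpleGraph X) [G.LocallyFinite] (q : ℕ) (o u x : X) :
    ℝ :=
  inverseGeomSum q (G.dist o x - G.dist o (treeParent G o u)) *
    ((if IsTreeDescendant G o u x then 1 else 0) -
      ((treeChildren G o (treeParent G o u)).card : ℝ)⁻¹ *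
        (if IsTreeDescendant G o (treeParent G o u) x then 1 else 0))

variable {X : Type*} {G : SimpleGraph X} [G.LocallyFinite] {q : ℕ} {o u x : X}

theorem treeBump_eq_zero_of_dist_le (h : G.dist o x ≤ G.dist o (treeParent G o u)) :
    treeBump G q o u x = 0 := by
  rw [treeBump, Nat.sub_eq_zero_of_le h, inverseGeomSum_zero, zero_mul]

theorem isTreeDescendant_of_treeBump_ne_zero (h : treeBump G q o u x ≠ 0) :
    IsTreeDescendant G o (treeParent G o u) x := by
  by_contra h'
  have h2 : ¬ IsTreeDescendant G o u x := fun h2 => h' h2.treeParent_left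
  exact h (by simp [treeBump, h', h2])

theorem card_treeChildren_ne_zero [q.AtLeastTwo] (hG : IsHomogeneousTree G q) (v : X) :
    ((treeChildren G o v).card : ℝ) ≠ 0 := by
  have hq := Nat.AtLeastTwo.prop (n := q)
  by_cases hv : v = o
  · subst hv
    rw [card_treeChildren_root hG]
    exact_mod_cast q.succ_ne_zero
  · rw [card_treeChildren hG hv]
    exact_mod_cast (by omega : q ≠ 0)

theorem inv_card_treeChildren_le [q.AtLeastTwo] (hG : IsHomogeneousTree G q) (v : X) :
    ((treeChildren G o v).card : ℝ)⁻¹ ≤ 1 / 2 := by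
  have hq := cast_pos_of_atLeastTwo q
  refine le_trans ?_ (inv_cast_le_half q)
  refine inv_anti₀ hq ?_
  by_cases hv : v = o
  · subst hv
    rw [card_treeChildren_root hG]
    exact_mod_cast q.le_succ
  · rw [card_treeChildren hG hv]

theorem abs_treeBump_le [q.AtLeastTwo] (hG : IsHomogeneousTree G q) (u x : X) :
    |treeBump G q o u x| ≤ 2 := by
  have h1 := inv_card_treeChildren_le (o := o) hG (treeParent G o u)
  have h2 : (0 : ℝ) ≤ ((treeChildren G o (treeParent G o u)).card : ℝ)⁻¹ := by positivity
  have h3 := inverseGeomSum_le_two (q := q) (G.dist o x - G.dist o (treeParent G o u))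
  have h4 := inverseGeomSum_nonneg (q := q) (G.dist o x - G.dist o (treeParent G o u))
  rw [treeBump, abs_mul, abs_of_nonneg h4]
  refine (mul_le_mul (d := 1) h3 ?_ (abs_nonneg _) two_pos.le).trans_eq (mul_one 2)
  rw [abs_le]
  split_ifs <;> constructor <;> linarith

theorem half_le_treeBump [q.AtLeastTwo] (hG : IsHomogeneousTree G q) (hu : u ≠ o) :
    1 / 2 ≤ treeBump G q o u u := by
  have h1 := inv_card_treeChildren_le (o := o) hG (treeParent G o u)
  have h2 := (treeParent_spec hG.isTree hu).2
  rw [treeBump, if_pos (.refl u), if_pos (IsTreeDescendant.refl u).treeParent_left,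
    ← h2, Nat.add_sub_cancel_left, inverseGeomSum_one]
  linarith

theorem treeBump_eq_zero_of_isTreeDescendant (hG : G.IsTree) (h : IsTreeDescendant G o x u)
    (hne : u ≠ x) : treeBump G q o u x = 0 := by
  refine treeBump_eq_zero_of_dist_le ?_
  exact ((isTreeDescendant_iff.1 h).resolve_left hne).dist_le hG

theorem treeBump_nonneg [q.AtLeastTwo] (hG : IsHomogeneousTree G q)
    (h : IsTreeDescendant G o u x) : 0 ≤ treeBump G q o u x := by
  have h1 := inv_card_treeChildren_le (o := o) hG (treeParent G o u)
  rw [treeBump, if_pos h, if_pos h.treeParent_left]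
  refine mul_nonneg (inverseGeomSum_nonneg _) (by linarith)

theorem isTreeDescendant_iff_of_mem_treeChildren (hG : G.IsTree) {v x y : X}
    (hy : y ∈ treeChildren G o x) :
    IsTreeDescendant G o v y ↔ y = v ∨ IsTreeDescendant G o v x := by
  rw [isTreeDescendant_iff, ((mem_treeChildren hG).1 hy).2]

/-- The coefficient subtracted in `treeBump` is chosen for this: the values on the children of the
parent have mean zero, so extending by zero keeps the function harmonic there. -/
theorem sum_treeBump_treeChildren_treeParent [q.AtLeastTwo] (hG : IsHomogeneousTree G q)
    (hu : u ≠ o) : ∑ y ∈ treeChildren G o (treeParent G o u), treeBump G q o u y = 0 := by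
  classical
  have hpu := (treeParent_spec hG.isTree hu).2
  have hmem : u ∈ treeChildren G o (treeParent G o u) := (mem_treeChildren hG.isTree).2 ⟨hu, rfl⟩
  have : ∀ y ∈ treeChildren G o (treeParent G o u), treeBump G q o u y =
      (if y = u then 1 else 0) - ((treeChildren G o (treeParent G o u)).card : ℝ)⁻¹ := by
    intro y hy
    have h1 : IsTreeDescendant G o u y ↔ y = u := by
      rw [isTreeDescendant_iff_of_mem_treeChildren hG.isTree hy]
      refine or_iff_left fun h => ?_
      have := h.dist_le hG.isTree
      omega
    have h2 : IsTreeDescendant G o (treeParent G o u) y :=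
      (isTreeDescendant_iff_of_mem_treeChildren hG.isTree hy).2 (.inr (.refl _))
    simp only [treeBump, dist_of_mem_treeChildren hy, Nat.add_sub_cancel_left,
      inverseGeomSum_one, h1, if_pos h2, one_mul, mul_one]
  rw [Finset.sum_congr rfl this, Finset.sum_sub_distrib, Finset.sum_ite_eq' _ _ _, if_pos hmem,
    Finset.sum_const, nsmul_eq_mul, mul_inv_cancel₀ (card_treeChildren_ne_zero hG _), sub_self]

theorem sum_treeBump_treeChildren [q.AtLeastTwo] (hG : IsHomogeneousTree G q)
    (hu : u ≠ o) {x : X} (hx : x ≠ o) :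
    ∑ y ∈ treeChildren G o x, treeBump G q o u y =
      ((q : ℝ) + 1) * treeBump G q o u x - treeBump G q o u (treeParent G o x) := by
  classical
  have hpu := (treeParent_spec hG.isTree hu).2
  have hpx := (treeParent_spec hG.isTree hx).2
  by_cases hxp : x = treeParent G o u
  · rw [hxp, sum_treeBump_treeChildren_treeParent hG hu, treeBump_eq_zero_of_dist_le le_rfl,
      treeBump_eq_zero_of_dist_le (by rw [dist_treeParent hG.isTree]; omega)]
    ring
  have hyu : ∀ y ∈ treeChildren G o x, y ≠ u := by
    rintro y hy rfl
    exact hxp ((mem_treeChildren hG.isTree).1 hy).2.symm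
  rcases le_or_gt (G.dist o x) (G.dist o (treeParent G o u)) with hle | hlt
  · rw [treeBump_eq_zero_of_dist_le hle, treeBump_eq_zero_of_dist_le (by omega),
      Finset.sum_eq_zero fun y hy => ?_]
    · ring
    by_contra h
    have h1 := isTreeDescendant_of_treeBump_ne_zero h
    rcases (isTreeDescendant_iff_of_mem_treeChildren hG.isTree hy).1 h1 with rfl | h2
    · exact h (treeBump_eq_zero_of_dist_le le_rfl)
    · exact hxp (h2.eq_of_dist_le hG.isTree hle)
  obtain ⟨n, hn⟩ : ∃ n, G.dist o x = G.dist o (treeParent G o u) + (n + 1) :=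
    ⟨G.dist o x - G.dist o (treeParent G o u) - 1, by omega⟩
  -- Strictly below the parent of `u` the angular factor is the same at `x` and at its children, so
  -- only the radial recursion remains.
  set χ : ℝ := (if IsTreeDescendant G o u x then 1 else 0) -
      ((treeChildren G o (treeParent G o u)).card : ℝ)⁻¹ *
        (if IsTreeDescendant G o (treeParent G o u) x then 1 else 0) with hχ
  have h1 : ∀ y ∈ treeChildren G o x, treeBump G q o u y = inverseGeomSum q (n + 2) * χ := by
    intro y hy
    have e1 : IsTreeDescendant G o u y ↔ IsTreeDescendant G o u x := by
      rw [isTreeDescendant_iff_of_mem_treeChildren hG.isTree hy]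
      exact or_iff_right (hyu y hy)
    have e2 : IsTreeDescendant G o (treeParent G o u) y ↔
        IsTreeDescendant G o (treeParent G o u) x := by
      rw [isTreeDescendant_iff_of_mem_treeChildren hG.isTree hy]
      refine or_iff_right ?_
      rintro rfl
      have := dist_of_mem_treeChildren hy
      omega
    simp only [treeBump, e1, e2]
    rw [dist_of_mem_treeChildren hy, hn, Nat.add_assoc, Nat.add_sub_cancel_left]
  have h2 : treeBump G q o u x = inverseGeomSum q (n + 1) * χ := by
    rw [treeBump, hn, Nat.add_sub_cancel_left]
  -- Passing from `u` to its parent changes the angular factor, but there the radial factor is zero.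
  have h3 : treeBump G q o u (treeParent G o x) = inverseGeomSum q n * χ := by
    by_cases hxu : x = u
    · subst hxu
      obtain rfl : n = 0 := by omega
      rw [treeBump_eq_zero_of_dist_le le_rfl, inverseGeomSum_zero, zero_mul]
    · have e1 := isTreeDescendant_iff (G := G) (o := o) (v := u) (x := x)
      rw [or_iff_right hxu] at e1
      have e2 := isTreeDescendant_iff (G := G) (o := o) (v := treeParent G o u) (x := x)
      rw [or_iff_right hxp] at e2
      simp only [hχ, e1, e2]
      rw [treeBump, dist_treeParent hG.isTree, hn]
      congr 2
      omega
  rw [Finset.sum_congr rfl h1, Finset.sum_const, card_treeChildren hG hx, h2, h3, nsmul_eq_mul]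
  linear_combination -χ * inverseGeomSum_harmonic (q := q) n

theorem isTreeHarmonic_treeBump [q.AtLeastTwo] (hG : IsHomogeneousTree G q) (hu : u ≠ o) :
    IsTreeHarmonic G q fun x => (treeBump G q o u x : ℂ) := by
  refine isTreeHarmonic_iff.2 fun x => ?_
  by_cases hx : x = o
  · subst hx
    have h0 : treeBump G q x u x = 0 :=
      treeBump_eq_zero_of_dist_le (by rw [SimpleGraph.dist_self]; exact Nat.zero_le _)
    rw [← treeChildren_root, h0, Complex.ofReal_zero, mul_zero, ← Complex.ofReal_sum,
      Complex.ofReal_eq_zero]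
    by_cases hp : treeParent G x u = x
    · have := sum_treeBump_treeChildren_treeParent hG hu
      rwa [hp] at this
    · refine Finset.sum_eq_zero fun y hy => treeBump_eq_zero_of_dist_le ?_
      have h1 := dist_of_mem_treeChildren hy
      rw [SimpleGraph.dist_self] at h1
      have h2 := hG.isTree.connected.pos_dist_of_ne (Ne.symm hp)
      omega
  · rw [sum_neighborFinset_eq hG.isTree _ hx, ← Complex.ofReal_sum,
      sum_treeBump_treeChildren hG hu hx]
    push_cast
    ring

end Bump

/-! ### The reproducing kernel and its recursion along geodesics. -/

/-- The normalising constant of `treeBump` in the harmonic Bergman space. -/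
noncomputable def bergmanConstant (q : ℕ) (c : ℝ) : ℝ :=
  ∑' n : ℕ, inverseGeomSum q (n + 1) ^ 2 * (q : ℝ) ^ n * ((q : ℝ) ^ (-c)) ^ (n + 1)

theorem summable_bergmanConstant (q : ℕ) [q.AtLeastTwo] {c : ℝ} (hc : 1 < c) :
    Summable fun n : ℕ =>
      inverseGeomSum q (n + 1) ^ 2 * (q : ℝ) ^ n * ((q : ℝ) ^ (-c)) ^ (n + 1) := by
  have hq := cast_pos_of_atLeastTwo q
  refine Summable.of_nonneg_of_le (fun n => by positivity) (fun n => ?_)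
    ((summable_geometric_of_lt_one (by positivity) (mul_rpow_neg_lt_one (q := q) hc)).mul_left
      (2 ^ 2 * (q : ℝ) ^ (-c)))
  have h1 := inverseGeomSum_le_two (q := q) (n + 1)
  have h2 := inverseGeomSum_nonneg (q := q) (n + 1)
  calc _ ≤ (2 : ℝ) ^ 2 * (q : ℝ) ^ n * ((q : ℝ) ^ (-c)) ^ (n + 1) := by gcongr
    _ = _ := by ring

theorem bergmanConstant_pos (q : ℕ) [q.AtLeastTwo] {c : ℝ} (hc : 1 < c) :
    0 < bergmanConstant q c := by
  have hq := cast_pos_of_atLeastTwo q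
  refine (summable_bergmanConstant q hc).tsum_pos (fun n => by positivity) 0 ?_
  simp only [zero_add, inverseGeomSum_one]
  positivity

section Kernel

variable {X : Type*} [MeasurableSpace X] [DiscreteMeasurableSpace X] {G : SimpleGraph X}
  [G.LocallyFinite] {q : ℕ} [q.AtLeastTwo] {o : X} {c : ℝ}

theorem smul_bergmanSpace_apply (k : ℂ) (f : bergmanSpace G q o c) (x : X) :
    (k • f) x = k * f x :=
  congrFun ((RKHS.coeCLM ℂ : bergmanSpace G q o c →L[ℂ] X → ℂ).map_smul k f) x

theorem inner_smul_bergmanSpace (k : ℂ) (f g : bergmanSpace G q o c) :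
    inner ℂ (k • f) g = starRingEnd ℂ k * inner ℂ f g := inner_smul_left f g k

theorem inner_kerFun_one (z : X) (g : bergmanSpace G q o c) :
    inner ℂ (RKHS.kerFun (bergmanSpace G q o c) z 1) g = g z := by
  rw [RKHS.kerFun_inner, RCLike.inner_apply, map_one, mul_one]

theorem bergmanKernel_conj_symm (z x : X) :
    starRingEnd ℂ (bergmanKernel G q o c z x) = bergmanKernel G q o c x z := by
  rw [bergmanKernel, bergmanKernel, ← inner_kerFun_one, ← inner_kerFun_one]
  exact inner_conj_symm (𝕜 := ℂ) (E := bergmanSpace G q o c) _ _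

theorem norm_bergmanKernel_comm (z x : X) :
    ‖bergmanKernel G q o c z x‖ = ‖bergmanKernel G q o c x z‖ := by
  rw [← bergmanKernel_conj_symm, RCLike.norm_conj]

/-- Weight and radial factor are constant on each generation below the parent, so the inner product
only sees the sums of `IsTreeHarmonic.sum_treeDescendants_sub`, all multiples of one second
difference. One factor `inverseGeomSum` comes from the bump and one from `g`, whence the square in
`bergmanConstant`. -/
theorem inner_eq_of_eq_treeBump (hG : IsHomogeneousTree G q) (hc : 1 < c) {u : X} (hu : u ≠ o)
    {F : bergmanSpace G q o c} (hF : ∀ x, F x = (treeBump G q o u x : ℂ))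
    (g : bergmanSpace G q o c) :
    inner ℂ F g = ((treeWeight G q o c (treeParent G o u) * bergmanConstant q c : ℝ) : ℂ) *
      ((g u - g (treeParent G o u)) -
        (q : ℂ)⁻¹ * (g (treeParent G o u) - g (treeParent G o (treeParent G o u)))) := by
  set p := treeParent G o u with hp
  have hT := hG.isTree
  have hg := bergmanSpace_isTreeHarmonic g
  have hpu : G.dist o p + 1 = G.dist o u := (treeParent_spec hT hu).2
  have h1 := hasSum_inner_bergmanSpace hT F g
  have h2 := hasSum_sum_treeDescendants hT (p := p) (fun x hx => by
    refine isTreeDescendant_of_treeBump_ne_zero (q := q) fun h => hx ?_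
    rw [hF, h, Complex.ofReal_zero, map_zero, zero_mul, mul_zero]) h1.summable
  rw [h1.tsum_eq] at h2
  -- Generation 0 is dropped because the bump vanishes at `p`.
  have h3 := (hasSum_nat_add_iff' 1).2 h2
  have h0 : ∑ i ∈ Finset.range 1, ∑ x ∈ treeDescendants G o i p,
      (treeWeight G q o c x : ℂ) * (starRingEnd ℂ (F x) * g x) = 0 := by
    simp [treeDescendants, hF, treeBump_eq_zero_of_dist_le le_rfl, hp]
  rw [h0, sub_zero] at h3
  refine h3.unique ?_
  set d : ℂ := (g u - g p) - (q : ℂ)⁻¹ * (g p - g (treeParent G o p)) with hd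
  have h4 := ((Complex.hasSum_ofReal.2 (summable_bergmanConstant q hc).hasSum).mul_left
    (treeWeight G q o c p : ℂ)).mul_right d
  rw [Complex.ofReal_mul]
  refine h4.congr_fun fun n => ?_
  classical
  have h5 : ∀ x ∈ treeDescendants G o (n + 1) p,
      (treeWeight G q o c x : ℂ) * (starRingEnd ℂ (F x) * g x) =
      (treeWeight G q o c p : ℂ) * (((q : ℝ) ^ (-c) : ℝ) : ℂ) ^ (n + 1) *
        (inverseGeomSum q (n + 1) : ℂ) * ((if IsTreeDescendant G o u x then g x else 0) -
          ((treeChildren G o p).card : ℂ)⁻¹ * g x) := by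
    intro x hx
    obtain ⟨hx1, hx2⟩ := (mem_treeDescendants_iff hT).1 hx
    rw [hF, Complex.conj_ofReal, treeWeight_eq_of_dist hx1, treeBump, ← hp, hx1,
      Nat.add_sub_cancel_left, if_pos hx2]
    split_ifs <;> push_cast <;> ring
  have h6 : ∑ x ∈ treeDescendants G o (n + 1) p, (if IsTreeDescendant G o u x then g x else 0) =
      ∑ x ∈ treeDescendants G o n u, g x := by
    rw [← Finset.sum_filter]
    refine Finset.sum_congr ?_ fun _ _ => rfl
    ext x
    rw [Finset.mem_filter, mem_treeDescendants_iff hT, mem_treeDescendants_iff hT]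
    constructor
    · rintro ⟨⟨h, -⟩, h'⟩
      exact ⟨by omega, h'⟩
    · rintro ⟨h, h'⟩
      exact ⟨⟨by omega, h'.treeParent_left⟩, h'⟩
  rw [Finset.sum_congr rfl h5, ← Finset.mul_sum, Finset.sum_sub_distrib, h6, ← Finset.mul_sum,
    hp, hg.sum_treeDescendants_sub hG n hu, ← hp, ← hd]
  push_cast
  ring

/-- By the mean value property on spheres around `o`, integration against a radial measure is
evaluation at `o` times the total mass. -/
theorem bergmanKernel_root (hG : IsHomogeneousTree G q) (hc : 1 < c) (x : X) :
    bergmanKernel G q o c o x = (((∑' y, treeWeight G q o c y)⁻¹ : ℝ) : ℂ) := by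
  have hT := hG.isTree
  have hsum := summable_treeWeight (o := o) hG hc
  have hpos : 0 < ∑' y, treeWeight G q o c y :=
    hsum.tsum_pos (fun y => (treeWeight_pos c y).le) o (treeWeight_pos c o)
  obtain ⟨F, hF⟩ := exists_bergmanSpace_of_bounded (o := o) hG hc
    (f := fun _ => (((∑' y, treeWeight G q o c y)⁻¹ : ℝ) : ℂ)) (isTreeHarmonic_iff.2 fun v => by
      rw [Finset.sum_const, SimpleGraph.card_neighborFinset_eq_degree, hG.isRegular v,
        nsmul_eq_mul, Nat.cast_succ]) _ (fun _ => le_rfl)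
  suffices h : RKHS.kerFun (bergmanSpace G q o c) o 1 = F by rw [bergmanKernel, h, hF]
  refine ext_inner_right ℂ fun g => ?_
  rw [inner_kerFun_one]
  have h1 := hasSum_inner_bergmanSpace hT F g
  have h2 := hasSum_sum_treeDescendants hT (p := o) (fun x _ => isTreeDescendant_root hT x)
    h1.summable
  rw [h1.tsum_eq] at h2
  refine HasSum.unique ?_ h2
  have h3 := hasSum_sum_treeDescendants hT (p := o)
    (fun x _ => isTreeDescendant_root hT x) (Complex.hasSum_ofReal.2 hsum.hasSum).summable
  rw [← Complex.ofReal_tsum] at h3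
  have h4 := h3.mul_left ((((∑' y, treeWeight G q o c y)⁻¹ : ℝ) : ℂ) * g o)
  rw [mul_right_comm, ← Complex.ofReal_mul, inv_mul_cancel₀ hpos.ne', Complex.ofReal_one,
    one_mul] at h4
  refine h4.congr_fun fun n => ?_
  have h5 : ∀ x ∈ treeDescendants G o n o, treeWeight G q o c x = (q : ℝ) ^ (-c * (n : ℝ)) := by
    intro x hx
    rw [treeWeight, (mem_treeDescendants_root hT).1 hx]
  have h6 : ∀ x ∈ treeDescendants G o n o,
      (treeWeight G q o c x : ℂ) * (starRingEnd ℂ (F x) * g x) =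
      (((q : ℝ) ^ (-c * (n : ℝ)) : ℝ) : ℂ) * (((∑' y, treeWeight G q o c y)⁻¹ : ℝ) : ℂ) * g x := by
    intro x hx
    rw [h5 x hx, hF, Complex.conj_ofReal, mul_assoc]
  rw [Finset.sum_congr rfl h6, ← Finset.mul_sum,
    (bergmanSpace_isTreeHarmonic g).sum_treeDescendants_root hG,
    Finset.sum_congr rfl fun x hx => congrArg Complex.ofReal (h5 x hx), Finset.sum_const,
    nsmul_eq_mul]
  ring

/-- Both sides represent the same functional on the Bergman space, by `inner_eq_of_eq_treeBump`. -/
theorem bergmanKernel_sub_treeParent (hG : IsHomogeneousTree G q) (hc : 1 < c) {u : X}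
    (hu : u ≠ o) (x : X) :
    bergmanKernel G q o c u x - bergmanKernel G q o c (treeParent G o u) x =
      (q : ℂ)⁻¹ * (bergmanKernel G q o c (treeParent G o u) x -
        bergmanKernel G q o c (treeParent G o (treeParent G o u)) x) +
      (((treeWeight G q o c (treeParent G o u) * bergmanConstant q c)⁻¹ *
        treeBump G q o u x : ℝ) : ℂ) := by
  set p := treeParent G o u with hp
  set m : ℝ := treeWeight G q o c p * bergmanConstant q c with hm
  have hm0 : (m : ℂ) ≠ 0 := by
    rw [Complex.ofReal_ne_zero]
    exact (mul_pos (treeWeight_pos c p) (bergmanConstant_pos q hc)).ne'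
  obtain ⟨F, hF⟩ := exists_bergmanSpace_of_bounded (o := o) hG hc (isTreeHarmonic_treeBump hG hu) 2
    (fun x => by rw [Complex.norm_real]; exact abs_treeBump_le hG u x)
  have key : RKHS.kerFun (bergmanSpace G q o c) u 1 - RKHS.kerFun (bergmanSpace G q o c) p 1 =
      (q : ℂ)⁻¹ • (RKHS.kerFun (bergmanSpace G q o c) p 1 -
        RKHS.kerFun (bergmanSpace G q o c) (treeParent G o p) 1) + (m : ℂ)⁻¹ • F := by
    refine ext_inner_right ℂ fun g => ?_
    rw [inner_add_left, inner_smul_bergmanSpace, inner_smul_bergmanSpace, inner_sub_left, inner_sub_left,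
      inner_kerFun_one, inner_kerFun_one, inner_kerFun_one, inner_eq_of_eq_treeBump hG hc hu hF g,
      ← hp, ← hm, map_inv₀, map_inv₀, Complex.conj_ofReal, Complex.conj_natCast,
      inv_mul_cancel_left₀ hm0]
    ring
  have := congrArg (fun f : bergmanSpace G q o c => f x) key
  simp only [RKHS.coe_sub, RKHS.coe_add, Pi.sub_apply, Pi.add_apply, smul_bergmanSpace_apply,
    hF] at this
  rw [bergmanKernel, bergmanKernel, bergmanKernel, this]
  push_cast
  ring

end Kernel

/-! ### Comparison of geometric sums with geometric growth. -/

section GeometricGrowth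

/-- The three conclusions come from keeping the first term, the last term, and all n + 1 terms of
the sum. -/
theorem growth_of_geom_sum_le {r ρ C : ℝ} (hr : 0 < r) (hρ : 0 < ρ)
    (h : ∀ n : ℕ, ∑ j ∈ Finset.range (n + 1), r ^ j ≤ C * ρ ^ n) :
    1 ≤ ρ ∧ r ≤ ρ ∧ (r = 1 → ρ ≠ 1) := by
  have h1 : ∀ n : ℕ, 1 ≤ C * ρ ^ n := fun n => by
    refine le_trans ?_ (h n)
    rw [Finset.sum_range_succ', pow_zero]
    have : 0 ≤ ∑ k ∈ Finset.range n, r ^ (k + 1) := Finset.sum_nonneg fun _ _ => by positivity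
    linarith
  have h2 : ∀ n : ℕ, r ^ n ≤ C * ρ ^ n := fun n => by
    refine le_trans ?_ (h n)
    rw [Finset.sum_range_succ]
    have : 0 ≤ ∑ k ∈ Finset.range n, r ^ k := Finset.sum_nonneg fun _ _ => by positivity
    linarith
  have hC : 0 < C := by
    have := h1 0
    rw [pow_zero] at this
    linarith
  refine ⟨?_, ?_, ?_⟩
  · by_contra! hlt
    obtain ⟨n, hn⟩ := exists_pow_lt_of_lt_one (inv_pos.2 hC) hlt
    have := mul_lt_mul_of_pos_left hn hC
    rw [mul_inv_cancel₀ hC.ne'] at this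
    linarith [h1 n]
  · by_contra! hlt
    obtain ⟨n, hn⟩ := pow_unbounded_of_one_lt C ((one_lt_div hρ).2 hlt)
    rw [div_pow, lt_div_iff₀ (by positivity)] at hn
    linarith [h2 n]
  · rintro rfl rfl
    obtain ⟨n, hn⟩ := exists_nat_gt C
    have := h n
    simp only [one_pow, Finset.sum_const, Finset.card_range, nsmul_eq_mul, mul_one] at this
    push_cast at this
    linarith

theorem exists_geom_sum_le {r ρ : ℝ} (hr : 0 < r) (hρ : 1 ≤ ρ) (hrρ : r ≤ ρ)
    (h : r < 1 ∨ 1 < ρ) : ∃ C : ℝ, 0 ≤ C ∧ ∀ n : ℕ, ∑ j ∈ Finset.range n, r ^ j ≤ C * ρ ^ n := by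
  rcases h with h | h
  · refine ⟨(1 - r)⁻¹, inv_nonneg.2 (by linarith), fun n => ?_⟩
    have h1 : ∑ j ∈ Finset.range n, r ^ j ≤ (1 - r)⁻¹ := by
      rw [← tsum_geometric_of_lt_one hr.le h]
      exact (summable_geometric_of_lt_one hr.le h).sum_le_tsum _ fun _ _ => by positivity
    have h2 : 0 ≤ (1 - r)⁻¹ := inv_nonneg.2 (by linarith)
    nlinarith [one_le_pow₀ hρ (n := n)]
  · have h0 : 0 < ρ - 1 := by linarith
    refine ⟨(ρ - 1)⁻¹, (inv_pos.2 h0).le, fun n => ?_⟩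
    calc ∑ j ∈ Finset.range n, r ^ j ≤ ∑ j ∈ Finset.range n, ρ ^ j :=
          Finset.sum_le_sum fun j _ => pow_le_pow_left₀ hr.le hrρ j
      _ = (ρ ^ n - 1) / (ρ - 1) := geom_sum_eq h.ne' n
      _ ≤ (ρ - 1)⁻¹ * ρ ^ n := by
        rw [div_eq_inv_mul]
        have := inv_pos.2 h0
        gcongr
        linarith

end GeometricGrowth

section WeightIdentities

variable {X : Type*} {G : SimpleGraph X} {q : ℕ} [q.AtLeastTwo] {o : X}

theorem enorm_treeWeight (β : ℝ) (x : X) :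
    ‖((treeWeight G q o β x : ℝ) : ℂ)‖ₑ = ENNReal.ofReal (treeWeight G q o β x) := by
  rw [← ofReal_norm, Complex.norm_real, Real.norm_of_nonneg (treeWeight_pos β x).le]

theorem ofReal_treeWeight_add (β γ : ℝ) (x : X) :
    ENNReal.ofReal (treeWeight G q o (β + γ) x) =
      ENNReal.ofReal (treeWeight G q o β x) * ENNReal.ofReal (treeWeight G q o γ x) := by
  rw [treeWeight_add, ENNReal.ofReal_mul (treeWeight_pos β x).le]

theorem inv_treeWeight_mul_treeWeight (c β : ℝ) (x : X) :
    (treeWeight G q o c x)⁻¹ * treeWeight G q o β x = ((q : ℝ) ^ (c - β)) ^ G.dist o x := by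
  rw [treeWeight, treeWeight, ← Real.rpow_neg (cast_pos_of_atLeastTwo q).le,
    ← Real.rpow_add (cast_pos_of_atLeastTwo q), ← Real.rpow_natCast,
    ← Real.rpow_mul (cast_pos_of_atLeastTwo q).le]
  congr 1
  ring

theorem pow_mul_treeWeight (α b : ℝ) (z : X) :
    ((q : ℝ) ^ (b - α)) ^ G.dist o z * treeWeight G q o b z = treeWeight G q o α z := by
  have := treeWeight_pos (G := G) (q := q) (o := o) b z
  rw [← inv_treeWeight_mul_treeWeight (G := G) (q := q) (o := o) b α z]
  field_simp

end WeightIdentities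

/-! ### The test on point masses. -/

section Schur

variable {X : Type*} [MeasurableSpace X] [DiscreteMeasurableSpace X] {G : SimpleGraph X}
  {q : ℕ} [q.AtLeastTwo] {o : X}

/-- An integral operator is bounded on `L¹` if and only if it is bounded on point masses. -/
theorem isBoundedOnL1_iff (α a b : ℝ) (k : X → X → ℂ) :
    IsBoundedOnL1 G q o α a b k ↔ ∃ C : ℝ≥0, ∀ x,
      (∑' z, ENNReal.ofReal (treeWeight G q o (a + α) z) * ‖k z x‖ₑ) *
        ENNReal.ofReal (treeWeight G q o b x) ≤ C * ENNReal.ofReal (treeWeight G q o α x) := by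
  classical
  constructor
  · rintro ⟨C, hC⟩
    refine ⟨C, fun x => ?_⟩
    have hnorm : eLpNorm (Pi.single x 1 : X → ℂ) 1 (expMeasure G q o α) =
        ENNReal.ofReal (treeWeight G q o α x) := by
      rw [eLpNorm_one_expMeasure, tsum_eq_single x fun y hy => by
        rw [Pi.single_eq_of_ne hy, enorm_zero, mul_zero], Pi.single_eq_same, enorm_one, mul_one]
    obtain ⟨-, -, h⟩ := hC (Pi.single x 1)
      ⟨Measurable.of_discrete.aestronglyMeasurable, by rw [hnorm]; exact ENNReal.ofReal_lt_top⟩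
    rw [hnorm, eLpNorm_one_expMeasure] at h
    refine le_of_eq_of_le ?_ h
    rw [← ENNReal.tsum_mul_right]
    refine tsum_congr fun z => ?_
    rw [weightedTransform, tsum_eq_single x fun y hy => by
      rw [Pi.single_eq_of_ne hy, mul_zero, zero_mul], Pi.single_eq_same, mul_one, enorm_mul,
      enorm_mul, enorm_treeWeight, enorm_treeWeight, ofReal_treeWeight_add]
    ring
  · rintro ⟨C, hC⟩
    refine ⟨C, fun f hf => ?_⟩
    rw [memLp_one_expMeasure_iff, eLpNorm_one_expMeasure,
      eLpNorm_one_expMeasure]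
    rw [memLp_one_expMeasure_iff] at hf
    set N := ∑' x, ENNReal.ofReal (treeWeight G q o α x) * ‖f x‖ₑ with hN
    -- Tonelli turns the test on point masses into a bound for the absolute double series, which
    -- yields both the norm bound and, every weight being positive, convergence at each `z`.
    have hdouble : ∑' z, ENNReal.ofReal (treeWeight G q o (a + α) z) *
        ∑' x, ‖k z x * f x * (treeWeight G q o b x : ℂ)‖ₑ ≤ C * N := by
      simp_rw [← ENNReal.tsum_mul_left]
      rw [ENNReal.tsum_comm, hN, ← ENNReal.tsum_mul_left]
      refine ENNReal.tsum_le_tsum fun x => ?_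
      calc ∑' z, ENNReal.ofReal (treeWeight G q o (a + α) z) *
            ‖k z x * f x * (treeWeight G q o b x : ℂ)‖ₑ
          = (∑' z, ENNReal.ofReal (treeWeight G q o (a + α) z) * ‖k z x‖ₑ) *
            ENNReal.ofReal (treeWeight G q o b x) * ‖f x‖ₑ := by
              rw [mul_assoc, ← ENNReal.tsum_mul_right]
              refine tsum_congr fun z => ?_
              rw [enorm_mul, enorm_mul, enorm_treeWeight]
              ring
        _ ≤ C * ENNReal.ofReal (treeWeight G q o α x) * ‖f x‖ₑ := mul_le_mul_left (hC x) _
        _ = _ := mul_assoc _ _ _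
    have hfin : C * N < ∞ := ENNReal.mul_lt_top ENNReal.coe_lt_top hf
    have hbound : ∑' z, ENNReal.ofReal (treeWeight G q o α z) *
        ‖weightedTransform G q o a b k f z‖ₑ ≤ C * N := by
      refine le_trans (ENNReal.tsum_le_tsum fun z => ?_) hdouble
      rw [weightedTransform, enorm_mul, enorm_treeWeight, ofReal_treeWeight_add, ← mul_assoc,
        mul_comm (ENNReal.ofReal (treeWeight G q o α z))]
      exact mul_le_mul_right enorm_tsum_le_tsum_enorm _
    refine ⟨fun z => ?_, hbound.trans_lt hfin, hbound⟩
    have h1 : ∑' x, ‖k z x * f x * (treeWeight G q o b x : ℂ)‖ₑ ≠ ∞ := by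
      intro h
      have h2 := (ENNReal.le_tsum z).trans hdouble
      rw [h, ENNReal.mul_top (ENNReal.ofReal_pos.2 (treeWeight_pos _ z)).ne'] at h2
      exact hfin.ne (top_unique h2)
    refine Summable.of_norm ((ENNReal.summable_toReal h1).congr fun x => ?_)
    rw [toReal_enorm]

end Schur

/-! ### Two-sided estimates of the weighted `L¹` norm of the kernel. -/

section KernelEstimates

variable {X : Type*} [MeasurableSpace X] [DiscreteMeasurableSpace X] {G : SimpleGraph X}
  [G.LocallyFinite] {q : ℕ} [q.AtLeastTwo] {o : X} {c : ℝ}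

/-- Let M(z) and D(z) be the weighted norms of K_z and of its difference with the kernel at the
parent. The recursion gives D(u) ≤ D(p)/2 + C' r^{|p|}, and M(u) ≤ M(p) + D(u), so M + D grows by at
most 2C' r^{|p|} at each step away from `o`. -/
theorem exists_tsum_bergmanKernel_le (hG : IsHomogeneousTree G q) (hc : 1 < c) {β : ℝ}
    (hβ : 1 < β) : ∃ C : ℝ≥0, ∀ z, ∑' x, ENNReal.ofReal (treeWeight G q o β x) *
      ‖bergmanKernel G q o c z x‖ₑ ≤
        C * ENNReal.ofReal (1 + ∑ j ∈ Finset.range (G.dist o z), ((q : ℝ) ^ (c - β)) ^ j) := by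
  classical
  have hT := hG.isTree
  have hq := cast_pos_of_atLeastTwo q
  have hB := bergmanConstant_pos q hc
  set r : ℝ := (q : ℝ) ^ (c - β) with hr
  have hr0 : 0 < r := by positivity
  set M : X → ℝ≥0∞ := fun z => ∑' x, ENNReal.ofReal (treeWeight G q o β x) *
    ‖bergmanKernel G q o c z x‖ₑ with hM
  set D : X → ℝ≥0∞ := fun z => ∑' x, ENNReal.ofReal (treeWeight G q o β x) *
    ‖bergmanKernel G q o c z x - bergmanKernel G q o c (treeParent G o z) x‖ₑ with hD
  obtain ⟨C, hC⟩ := exists_tsum_treeWeight_le (o := o) hG hβ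
  set C' : ℝ≥0∞ := ENNReal.ofReal ((bergmanConstant q c)⁻¹ * 2) * C with hC'
  have hC'top : C' ≠ ∞ := ENNReal.mul_ne_top ENNReal.ofReal_ne_top ENNReal.coe_ne_top
  have hMo : M o ≠ ∞ := by
    simp only [hM, bergmanKernel_root hG hc]
    rw [ENNReal.tsum_mul_right]
    exact ENNReal.mul_ne_top (tsum_treeWeight_ne_top hG hβ) enorm_ne_top
  have hDo : D o = 0 := by simp [hD]
  -- The mass below p is of order q^{-β|p|} and the normalisation contributes q^{c|p|}; the product
  -- is r^{|p|}.
  have hbump : ∀ u, ∑' x, ENNReal.ofReal (treeWeight G q o β x) *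
      ‖(((treeWeight G q o c (treeParent G o u) * bergmanConstant q c)⁻¹ *
        treeBump G q o u x : ℝ) : ℂ)‖ₑ ≤ C' * ENNReal.ofReal (r ^ G.dist o (treeParent G o u)) := by
    intro u
    set p := treeParent G o u with hp
    have hwp := treeWeight_pos (G := G) (q := q) (o := o) c p
    have h1 : ∀ x, ENNReal.ofReal (treeWeight G q o β x) *
        ‖(((treeWeight G q o c p * bergmanConstant q c)⁻¹ * treeBump G q o u x : ℝ) : ℂ)‖ₑ ≤
        (if IsTreeDescendant G o p x then ENNReal.ofReal (treeWeight G q o β x) else 0) *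
          ENNReal.ofReal ((treeWeight G q o c p * bergmanConstant q c)⁻¹ * 2) := by
      intro x
      split_ifs with hx
      · gcongr
        rw [← ofReal_norm, Complex.norm_real, norm_mul,
          Real.norm_of_nonneg (by positivity : 0 ≤ (treeWeight G q o c p * bergmanConstant q c)⁻¹)]
        gcongr
        exact abs_treeBump_le hG u x
      · have : treeBump G q o u x = 0 := by
          by_contra h
          exact hx (isTreeDescendant_of_treeBump_ne_zero h)
        rw [this, mul_zero, Complex.ofReal_zero, enorm_zero, mul_zero, zero_mul]
    calc _ ≤ ∑' x, (if IsTreeDescendant G o p x then ENNReal.ofReal (treeWeight G q o β x) else 0) *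
          ENNReal.ofReal ((treeWeight G q o c p * bergmanConstant q c)⁻¹ * 2) :=
          ENNReal.tsum_le_tsum h1
      _ ≤ C * ENNReal.ofReal (treeWeight G q o β p) *
          ENNReal.ofReal ((treeWeight G q o c p * bergmanConstant q c)⁻¹ * 2) := by
          rw [ENNReal.tsum_mul_right]
          exact mul_le_mul_left (hC p) _
      _ = _ := by
          have e : treeWeight G q o β p * ((treeWeight G q o c p * bergmanConstant q c)⁻¹ * 2) =
              ((bergmanConstant q c)⁻¹ * 2) *
                ((treeWeight G q o c p)⁻¹ * treeWeight G q o β p) := by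
            rw [mul_inv]
            ring
          rw [mul_assoc, ← ENNReal.ofReal_mul (treeWeight_pos β p).le, e,
            inv_treeWeight_mul_treeWeight, ENNReal.ofReal_mul (by positivity), hC']
          ring
  -- The doubled form lets M + D telescope without subtraction in `ℝ≥0∞`.
  have hDu : ∀ u, u ≠ o → D u + D u ≤ D (treeParent G o u) +
      2 * (C' * ENNReal.ofReal (r ^ G.dist o (treeParent G o u))) := by
    intro u hu
    have h1 : D u ≤ ENNReal.ofReal (1 / 2) * D (treeParent G o u) +
        C' * ENNReal.ofReal (r ^ G.dist o (treeParent G o u)) := by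
      refine le_trans ?_ (add_le_add_right (hbump u) _)
      simp only [hD]
      rw [← ENNReal.tsum_mul_left, ← ENNReal.tsum_add]
      refine ENNReal.tsum_le_tsum fun x => ?_
      rw [bergmanKernel_sub_treeParent hG hc hu, mul_left_comm, ← mul_add]
      gcongr
      refine (enorm_add_le _ _).trans ?_
      gcongr
      rw [enorm_mul]
      gcongr
      rw [← ofReal_norm, norm_inv, Complex.norm_natCast]
      exact ENNReal.ofReal_le_ofReal (inv_cast_le_half q)
    have h2 : ENNReal.ofReal (1 / 2) + ENNReal.ofReal (1 / 2) = 1 := by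
      rw [← ENNReal.ofReal_add (by norm_num) (by norm_num)]
      norm_num
    calc D u + D u ≤ _ := add_le_add h1 h1
      _ = (ENNReal.ofReal (1 / 2) + ENNReal.ofReal (1 / 2)) * D (treeParent G o u) +
          2 * (C' * ENNReal.ofReal (r ^ G.dist o (treeParent G o u))) := by ring
      _ = _ := by rw [h2, one_mul]
  have hMu : ∀ u, M u ≤ M (treeParent G o u) + D u := by
    intro u
    simp only [hM, hD]
    rw [← ENNReal.tsum_add]
    refine ENNReal.tsum_le_tsum fun x => ?_
    rw [← mul_add]
    gcongr
    refine le_of_eq_of_le ?_ (enorm_add_le _ _)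
    rw [add_sub_cancel]
  have hV : ∀ z, M z + D z ≤ M o + 2 * C' *
      ENNReal.ofReal (∑ j ∈ Finset.range (G.dist o z), r ^ j) := by
    refine tree_induction hT (o := o) ?_ fun u hu ih => ?_
    · simp [hDo]
    · rw [← (treeParent_spec hT hu).2, Finset.sum_range_succ,
        ENNReal.ofReal_add (Finset.sum_nonneg fun _ _ => by positivity) (by positivity)]
      calc M u + D u ≤ M (treeParent G o u) + D u + D u := add_le_add_left (hMu u) _
        _ = M (treeParent G o u) + (D u + D u) := add_assoc _ _ _
        _ ≤ M (treeParent G o u) + (D (treeParent G o u) +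
          2 * (C' * ENNReal.ofReal (r ^ G.dist o (treeParent G o u)))) :=
            add_le_add_right (hDu u hu) _
        _ = (M (treeParent G o u) + D (treeParent G o u)) +
          2 * C' * ENNReal.ofReal (r ^ G.dist o (treeParent G o u)) := by ring
        _ ≤ _ := by
          rw [mul_add, ← add_assoc]
          exact add_le_add_left ih _
  have htop : M o + 2 * C' ≠ ∞ :=
    ENNReal.add_ne_top.2 ⟨hMo, ENNReal.mul_ne_top ENNReal.ofNat_ne_top hC'top⟩
  refine ⟨(M o + 2 * C').toNNReal, fun z => ?_⟩
  rw [ENNReal.coe_toNNReal htop, ENNReal.ofReal_add zero_le_one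
    (Finset.sum_nonneg fun _ _ => by positivity), ENNReal.ofReal_one, mul_add, mul_one]
  refine (le_self_add.trans (hV z)).trans ?_
  refine add_le_add le_self_add (mul_le_mul_left le_add_self _)

theorem re_bergmanKernel_sub_treeParent (hG : IsHomogeneousTree G q) (hc : 1 < c) {u : X}
    (hu : u ≠ o) (x : X) :
    (bergmanKernel G q o c u x).re - (bergmanKernel G q o c (treeParent G o u) x).re =
      (q : ℝ)⁻¹ * ((bergmanKernel G q o c (treeParent G o u) x).re -
        (bergmanKernel G q o c (treeParent G o (treeParent G o u)) x).re) +
      (treeWeight G q o c (treeParent G o u) * bergmanConstant q c)⁻¹ * treeBump G q o u x := by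
  have h := congrArg Complex.re (bergmanKernel_sub_treeParent hG hc hu x)
  have e : (q : ℂ)⁻¹ = (((q : ℝ)⁻¹ : ℝ) : ℂ) := by push_cast; rfl
  rw [e, Complex.add_re, Complex.re_ofReal_mul, Complex.ofReal_re, Complex.sub_re,
    Complex.sub_re] at h
  exact h

/-- At a point below `z`, all bumps met on the way from `o` to `z` are nonnegative, so by the
recursion the increments are too, starting from a positive constant. -/
theorem re_bergmanKernel_nonneg (hG : IsHomogeneousTree G q) (hc : 1 < c) (z : X) :
    ∀ x, IsTreeDescendant G o z x → 0 ≤ (bergmanKernel G q o c z x).re ∧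
      (bergmanKernel G q o c (treeParent G o z) x).re ≤ (bergmanKernel G q o c z x).re := by
  have hq := cast_pos_of_atLeastTwo q
  have hB := bergmanConstant_pos q hc
  induction z using tree_induction (o := o) hG.isTree with
  | h0 =>
    intro x _
    rw [treeParent_root, bergmanKernel_root hG hc, Complex.ofReal_re]
    exact ⟨inv_nonneg.2 (tsum_nonneg fun y => (treeWeight_pos c y).le), le_rfl⟩
  | h1 u hu ih =>
    intro x hx
    obtain ⟨h1, h2⟩ := ih x hx.treeParent_left
    have h3 := re_bergmanKernel_sub_treeParent hG hc hu x
    have h4 : 0 ≤ (q : ℝ)⁻¹ * ((bergmanKernel G q o c (treeParent G o u) x).re -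
        (bergmanKernel G q o c (treeParent G o (treeParent G o u)) x).re) :=
      mul_nonneg (by positivity) (by linarith)
    have h5 := treeWeight_pos (G := G) (q := q) (o := o) c (treeParent G o u)
    have h6 : 0 ≤ (treeWeight G q o c (treeParent G o u) * bergmanConstant q c)⁻¹ *
        treeBump G q o u x := mul_nonneg (by positivity) (treeBump_nonneg hG hx)
    constructor <;> linarith

/-- The kernel is large at the vertices of the geodesic from `o` to `z`. -/
theorem exists_le_re_bergmanKernel (hG : IsHomogeneousTree G q) (hc : 1 < c) :
    ∃ κ : ℝ, 0 < κ ∧ ∀ z x, IsTreeDescendant G o x z →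
      κ * (treeWeight G q o c x)⁻¹ ≤ (bergmanKernel G q o c z x).re := by
  have hq := cast_pos_of_atLeastTwo q
  have hB := bergmanConstant_pos q hc
  have hA : 0 < ∑' y, treeWeight G q o c y :=
    (summable_treeWeight hG hc).tsum_pos (fun y => (treeWeight_pos c y).le) o (treeWeight_pos c o)
  -- The first entry serves `x = o = z`. The second serves `x = z ≠ o`: the bump is at least 1/2 at
  -- its own vertex, and q^{-c} is the ratio of the weights at that vertex and at its parent.
  set κ : ℝ := min (∑' y, treeWeight G q o c y)⁻¹
    ((bergmanConstant q c)⁻¹ * (q : ℝ) ^ (-c) * (1 / 2)) with hκ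
  refine ⟨κ, lt_min (inv_pos.2 hA) (by positivity), fun z => ?_⟩
  suffices h : ∀ x, IsTreeDescendant G o x z →
      κ * (treeWeight G q o c x)⁻¹ ≤ (bergmanKernel G q o c z x).re ∧
      (bergmanKernel G q o c (treeParent G o z) x).re ≤ (bergmanKernel G q o c z x).re from
    fun x hx => (h x hx).1
  induction z using tree_induction (o := o) hG.isTree with
  | h0 =>
    intro x hx
    obtain rfl := isTreeDescendant_root_iff.1 hx
    refine ⟨?_, by rw [treeParent_root]⟩
    rw [bergmanKernel_root hG hc, Complex.ofReal_re, treeWeight, SimpleGraph.dist_self]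
    simp [hκ]
  | h1 u hu ih =>
    intro x hx
    have h3 := re_bergmanKernel_sub_treeParent hG hc hu x
    by_cases hux : u = x
    · subst hux
      obtain ⟨-, h2⟩ := re_bergmanKernel_nonneg hG hc u u (.refl u)
      refine ⟨?_, h2⟩
      obtain ⟨h4, h5⟩ := re_bergmanKernel_nonneg hG hc (treeParent G o u) u
        (IsTreeDescendant.refl u).treeParent_left
      have h6 : 0 ≤ (q : ℝ)⁻¹ * ((bergmanKernel G q o c (treeParent G o u) u).re -
          (bergmanKernel G q o c (treeParent G o (treeParent G o u)) u).re) :=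
        mul_nonneg (by positivity) (by linarith)
      have hw := treeWeight_pos (G := G) (q := q) (o := o) c (treeParent G o u)
      have h7 : κ * (treeWeight G q o c u)⁻¹ ≤
          (treeWeight G q o c (treeParent G o u) * bergmanConstant q c)⁻¹ *
            treeBump G q o u u := by
        have h8 := half_le_treeBump hG hu
        have h9 : treeWeight G q o c u =
            treeWeight G q o c (treeParent G o u) * ((q : ℝ) ^ (-c)) ^ 1 :=
          treeWeight_eq_of_dist (treeParent_spec hG.isTree hu).2.symm c
        rw [h9, pow_one]
        calc κ * (treeWeight G q o c (treeParent G o u) * (q : ℝ) ^ (-c))⁻¹ ≤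
            ((bergmanConstant q c)⁻¹ * (q : ℝ) ^ (-c) * (1 / 2)) *
              (treeWeight G q o c (treeParent G o u) * (q : ℝ) ^ (-c))⁻¹ := by
                gcongr
                exact min_le_right _ _
          _ = (treeWeight G q o c (treeParent G o u) * bergmanConstant q c)⁻¹ * (1 / 2) := by
                have : (q : ℝ) ^ (-c) ≠ 0 := by positivity
                field_simp
          _ ≤ _ := by gcongr
      linarith
    -- The bump of `u` vanishes at strict ancestors of `u`, so the new increment is q⁻¹ times the
    -- previous one and the lower bound persists.
    · have hx' := (isTreeDescendant_iff.1 hx).resolve_left hux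
      obtain ⟨h1, h2⟩ := ih x hx'
      rw [treeBump_eq_zero_of_isTreeDescendant hG.isTree hx hux, mul_zero, add_zero] at h3
      have h6 : 0 ≤ (q : ℝ)⁻¹ * ((bergmanKernel G q o c (treeParent G o u) x).re -
          (bergmanKernel G q o c (treeParent G o (treeParent G o u)) x).re) :=
        mul_nonneg (by positivity) (by linarith)
      constructor <;> linarith

theorem exists_le_tsum_bergmanKernel (hG : IsHomogeneousTree G q) (hc : 1 < c) (β : ℝ) :
    ∃ κ : ℝ, 0 < κ ∧ ∀ z : X,
      ENNReal.ofReal (κ * ∑ j ∈ Finset.range (G.dist o z + 1), ((q : ℝ) ^ (c - β)) ^ j) ≤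
      ∑' x, ENNReal.ofReal (treeWeight G q o β x) * ‖bergmanKernel G q o c z x‖ₑ := by
  classical
  have hq := cast_pos_of_atLeastTwo q
  obtain ⟨κ, hκ, h⟩ := exists_le_re_bergmanKernel (o := o) hG hc
  refine ⟨κ, hκ, fun z => ?_⟩
  -- The vertex at distance j from `o` on the geodesic to `z`; it alone contributes at least κ r^j.
  set y : ℕ → X := fun j => (treeParent G o)^[G.dist o z - j] z with hy
  have hdist : ∀ j ∈ Finset.range (G.dist o z + 1), G.dist o (y j) = j := fun j hj => by
    rw [Finset.mem_range] at hj
    rw [hy, dist_iterate_treeParent hG.isTree]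
    omega
  have hinj : Set.InjOn y (Finset.range (G.dist o z + 1)) := fun i hi j hj hij => by
    rw [← hdist i hi, ← hdist j hj, hij]
  refine le_trans ?_ (ENNReal.sum_le_tsum ((Finset.range (G.dist o z + 1)).image y))
  rw [Finset.sum_image hinj, Finset.mul_sum,
    ENNReal.ofReal_sum_of_nonneg fun _ _ => by positivity]
  refine Finset.sum_le_sum fun j hj => ?_
  have h1 := h z (y j) ⟨_, rfl⟩
  rw [← ofReal_norm, ← ENNReal.ofReal_mul (treeWeight_pos β _).le]
  refine ENNReal.ofReal_le_ofReal ?_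
  have h2 := inv_treeWeight_mul_treeWeight (G := G) (q := q) (o := o) c β (y j)
  rw [hdist j hj] at h2
  have h3 := treeWeight_pos (G := G) (q := q) (o := o) β (y j)
  calc κ * ((q : ℝ) ^ (c - β)) ^ j =
      treeWeight G q o β (y j) * (κ * (treeWeight G q o c (y j))⁻¹) := by rw [← h2]; ring
    _ ≤ _ := mul_le_mul_of_nonneg_left (h1.trans (Complex.re_le_norm _)) h3.le

/-! ### From the estimates to the conditions on the parameters. -/

theorem isBoundedS_iff_isBoundedT (α a b c : ℝ) :
    IsBoundedS G q o α a b c ↔ IsBoundedT G q o α a b c := by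
  rw [IsBoundedS, IsBoundedT, isBoundedOnL1_iff, isBoundedOnL1_iff]
  have : ∀ z x : X, ‖((‖bergmanKernel G q o c z x‖ : ℝ) : ℂ)‖ₑ = ‖bergmanKernel G q o c z x‖ₑ :=
    fun z x => by rw [← ofReal_norm, Complex.norm_real, norm_norm, ofReal_norm]
  simp only [this]

/-- Hermitian symmetry moves the sum to the second variable, so that it becomes a weighted norm of
K_c(z,·). -/
theorem isBoundedT_iff (α a b c : ℝ) :
    IsBoundedT G q o α a b c ↔ ∃ C : ℝ≥0, ∀ z,
      (∑' x, ENNReal.ofReal (treeWeight G q o (a + α) x) * ‖bergmanKernel G q o c z x‖ₑ) *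
        ENNReal.ofReal (treeWeight G q o b z) ≤ C * ENNReal.ofReal (treeWeight G q o α z) := by
  rw [IsBoundedT, isBoundedOnL1_iff]
  have : ∀ z x : X, ‖bergmanKernel G q o c z x‖ₑ = ‖bergmanKernel G q o c x z‖ₑ :=
    fun z x => by rw [← ofReal_norm, norm_bergmanKernel_comm, ofReal_norm]
  refine exists_congr fun C => forall_congr' fun z => ?_
  rw [tsum_congr fun x => by rw [this x z]]

theorem isBoundedT_of_conditions (hG : IsHomogeneousTree G q) {α a b c : ℝ} (hc : 1 < c)
    (h : (c = a + b ∧ -a < α - 1 ∧ α - 1 < b - 1) ∨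
        (c < a + b ∧ -a < α - 1 ∧ α - 1 ≤ b - 1)) : IsBoundedT G q o α a b c := by
  have hq := cast_pos_of_atLeastTwo q
  have hq1 := one_lt_cast_of_atLeastTwo q
  have hβ : 1 < a + α := by rcases h with h | h <;> linarith
  set ρ : ℝ := (q : ℝ) ^ (b - α) with hρ
  have hρ1 : 1 ≤ ρ := Real.one_le_rpow hq1.le (by rcases h with h | h <;> linarith)
  have hrρ : (q : ℝ) ^ (c - (a + α)) ≤ ρ :=
    Real.rpow_le_rpow_of_exponent_le hq1.le (by rcases h with h | h <;> linarith)
  -- If α = b, only the strict case c < a + b is left, and then r < 1.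
  have hor : (q : ℝ) ^ (c - (a + α)) < 1 ∨ 1 < ρ := by
    rcases lt_or_ge α b with hlt | hge
    · exact .inr (Real.one_lt_rpow hq1 (by linarith))
    · exact .inl (Real.rpow_lt_one_of_one_lt_of_neg hq1 (by rcases h with h | h <;> linarith))
  obtain ⟨C₁, hC₁, h₁⟩ := exists_geom_sum_le (by positivity) hρ1 hrρ hor
  obtain ⟨C, hC⟩ := exists_tsum_bergmanKernel_le (o := o) hG hc hβ
  refine (isBoundedT_iff α a b c).2 ⟨C * (1 + C₁).toNNReal, fun z => ?_⟩
  refine (mul_le_mul_left (hC z) _).trans ?_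
  rw [mul_assoc, ENNReal.coe_mul, mul_assoc]
  refine mul_le_mul_right ?_ _
  change _ ≤ ENNReal.ofReal (1 + C₁) * _
  rw [← ENNReal.ofReal_mul' (treeWeight_pos b z).le, ← ENNReal.ofReal_mul' (treeWeight_pos α z).le]
  refine ENNReal.ofReal_le_ofReal ?_
  rw [← pow_mul_treeWeight α b z, ← hρ, ← mul_assoc]
  refine mul_le_mul_of_nonneg_right ?_ (treeWeight_pos b z).le
  have := one_le_pow₀ hρ1 (n := G.dist o z)
  linarith [h₁ (G.dist o z)]

theorem IsBoundedT.conditions (hG : IsHomogeneousTree G q) {α a b c : ℝ} (hc : 1 < c)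
    (h : IsBoundedT G q o α a b c) : (c = a + b ∧ -a < α - 1 ∧ α - 1 < b - 1) ∨
        (c < a + b ∧ -a < α - 1 ∧ α - 1 ≤ b - 1) := by
  have hq := cast_pos_of_atLeastTwo q
  have hq1 := one_lt_cast_of_atLeastTwo q
  obtain ⟨C, hC⟩ := (isBoundedT_iff α a b c).1 h
  -- The test at `z = o`, where the kernel is a nonzero constant, bounds the total mass for the
  -- exponent a + α.
  have hβ : 1 < a + α := by
    refine one_lt_of_tsum_treeWeight_ne_top (o := o) hG fun htop => ?_
    have h1 := hC o
    have hA : 0 < ∑' y, treeWeight G q o c y :=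
      (summable_treeWeight hG hc).tsum_pos (fun y => (treeWeight_pos c y).le) o (treeWeight_pos c o)
    simp only [bergmanKernel_root hG hc] at h1
    rw [ENNReal.tsum_mul_right, htop, ENNReal.top_mul, ENNReal.top_mul
      (ENNReal.ofReal_pos.2 (treeWeight_pos b o)).ne'] at h1
    · exact ENNReal.mul_ne_top ENNReal.coe_ne_top ENNReal.ofReal_ne_top (top_unique h1)
    · rw [enorm_ne_zero, Complex.ofReal_ne_zero]
      exact (inv_pos.2 hA).ne'
  obtain ⟨κ, hκ, hlow⟩ := exists_le_tsum_bergmanKernel (o := o) hG hc (a + α)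
  have hsum : ∀ n : ℕ, ∑ j ∈ Finset.range (n + 1), ((q : ℝ) ^ (c - (a + α))) ^ j ≤
      (C / κ) * ((q : ℝ) ^ (b - α)) ^ n := by
    intro n
    obtain ⟨z, hz⟩ : (treeDescendants G o n o).Nonempty := by
      rw [← Finset.card_pos]
      have := Nat.AtLeastTwo.prop (n := q)
      exact (pow_pos (by omega) n).trans_le (pow_le_card_treeDescendants hG n o)
    rw [mem_treeDescendants_root hG.isTree] at hz
    have h1 := (mul_le_mul_left (hlow z) _).trans (hC z)
    rw [← ENNReal.ofReal_mul' (treeWeight_pos b z).le, ← ENNReal.ofReal_coe_nnreal,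
      ← ENNReal.ofReal_mul C.coe_nonneg, ENNReal.ofReal_le_ofReal_iff
        (mul_nonneg C.coe_nonneg (treeWeight_pos α z).le), ← pow_mul_treeWeight α b z, ← mul_assoc,
      mul_le_mul_iff_left₀ (treeWeight_pos b z), hz] at h1
    rw [div_mul_eq_mul_div, le_div_iff₀ hκ, mul_comm]
    exact h1
  obtain ⟨h1, h2, h3⟩ := growth_of_geom_sum_le (by positivity) (by positivity) hsum
  have h4 : α ≤ b := by
    by_contra! hlt
    linarith [Real.rpow_lt_one_of_one_lt_of_neg hq1 (by linarith : b - α < 0)]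
  rw [Real.rpow_le_rpow_left_iff hq1] at h2
  -- The alternative r < ρ or r = ρ is c < a + b or c = a + b; in the second case α = b would give r
  -- = ρ = 1.
  rcases h2.lt_or_eq with h5 | h5
  · exact .inr ⟨by linarith, by linarith, by linarith⟩
  · refine .inl ⟨by linarith, by linarith, ?_⟩
    have h6 : α ≠ b := by
      rintro rfl
      rw [h5, sub_self, Real.rpow_zero] at h3
      exact h3 rfl rfl
    linarith [lt_of_le_of_ne h4 h6]

end KernelEstimates

theorem mainTheorem5 {X : Type*} [MeasurableSpace X] [DiscreteMeasurableSpace X]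
    (G : SimpleGraph X) [G.LocallyFinite] (q : ℕ) [q.AtLeastTwo] (hG : IsHomogeneousTree G q)
    (o : X) (α a b c : ℝ) (hα : 1 < α) (hc : 1 < c) :
    List.TFAE [
      IsBoundedS G q o α a b c,
      IsBoundedT G q o α a b c,
      (c = a + b ∧ -a < α - 1 ∧ α - 1 < b - 1) ∨
        (c < a + b ∧ -a < α - 1 ∧ α - 1 ≤ b - 1)] := by
  tfae_have 1 ↔ 2 := isBoundedS_iff_isBoundedT α a b c
  tfae_have 2 → 3 := fun h => h.conditions hG hc
  tfae_have 3 → 2 := fun h => isBoundedT_of_conditions hG hc h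
  tfae_finish
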